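/- Let $X$ be a translation surface with non-empty finite singular set $\Sigma$: a connected closed surface with an atlas of charts to $\mathbb C$ on $X\setminus\Sigma$ whose transition maps are translations, such that each $x\in\Sigma$ is a cone point of angle $2\pi(k(x)+1)$ for some integer $k(x)\ge 1$, i.e. some neighbourhood of $x$ is homeomorphic, isometrically away from $x$, to a neighbourhood of the apex of the cone glued cyclically from $2k(x)+2$ Euclidean half planes. Let $\mathrm{Vol}_X$ be the flat area on $X$, and let $\pi:\widetilde X\to X$ be the universal cover with the lifted flat structure, its area $\mathrm{Vol}_{\widetilde X}$ and its flat length distance; let $\mathcal B(\widetilde x,R)\subset\widetilde X$ be the closed ball of radius $R$ about $\widetilde x$ for this distance. Then the volume entropy of $X$, $$h=\lim_{R\to\infty}\frac1R\log \mathrm{Vol}_{\widetilde X}(\mathcal B(\widetilde x,R)),$$ exists as a finite real number and is the same for every $\widetilde x\in\widetilde X$. Moreover, for every $\widetilde x\in\pi^{-1}(\Sigma)$ and every Borel set $A\subset X$ with $\mathrm{Vol}_X(A)>0$, writing $V_A(R)=\mathrm{Vol}_{\widetilde X}(\mathcal B(\widetilde x,R)\cap\pi^{-1}(A))$, the following limit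 exists and $$\lim_{R\to\infty}\frac1R\log V_A(R)=h.$$ -/

import Mathlib

open Set Filter Topology MeasureTheory
open scoped ENNReal unitInterval

/-- A translation structure on a surface `X` with singular set `sing`: an atlas of charts to `ℂ` on
`X \ sing` whose transition maps are (locally) translations, such that every `x ∈ sing` is a cone
point of angle `2 * π * (k + 1)` for some integer `k ≥ 1`.

The cone obtained by gluing `k + 1` upper and `k + 1` lower half planes cyclically along their
boundary rays is `ℂ` with the flat metric pulled back by `w ↦ w ^ (k + 1)`: the half planes are the
`2 * k + 2` closed sectors of angle `π / (k + 1)` that this map sends onto the closed upper or lower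
half plane. So `cone` says that a neighbourhood of `x` is homeomorphic to a neighbourhood of the apex
of that cone, by a homeomorphism which is a local isometry away from `x`.

The surface need not be compact, so that the structure also makes sense on the universal cover.
The fields force `sing` to be closed and discrete; if `X` is compact, then `sing` is finite. -/
structure TranslationStructure (X : Type*) [TopologicalSpace X] where
  sing : Set X
  charts : Set (OpenPartialHomeomorph X ℂ)
  source_subset : ∀ c ∈ charts, c.source ⊆ singᶜ
  covers : ∀ x ∉ sing, ∃ c ∈ charts, x ∈ c.source
  transition : ∀ c ∈ charts, ∀ c' ∈ charts, ∀ x ∈ c.source ∩ c'.source,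
    ∃ v : ℂ, ∀ᶠ y in 𝓝 x, c' y = c y + v
  cone : ∀ x ∈ sing, ∃ k : ℕ, 1 ≤ k ∧ ∃ ψ : OpenPartialHomeomorph X ℂ,
    x ∈ ψ.source ∧ ψ x = 0 ∧ ψ.source ∩ sing = {x} ∧
    ∀ c ∈ charts, ∀ y ∈ ψ.source ∩ c.source, ∃ N ∈ 𝓝 y, ∀ y₁ ∈ N, ∀ y₂ ∈ N,
      dist (c y₁) (c y₂) = dist (ψ y₁ ^ (k + 1)) (ψ y₂ ^ (k + 1))

namespace TranslationStructure

/-- A parametrized straight line segment with holonomy `v : ℂ`: a path `γ : [0, 1] → X` whose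
interior avoids the singularities and which is `t ↦ const + t * v` in charts locally on `(0, 1)`.
Its end points may be singular (for instance, if both are, it is a saddle connection). Its length
is `‖v‖`. -/
def IsSegment {X : Type*} [TopologicalSpace X] (M : TranslationStructure X)
    (γ : C(I, X)) (v : ℂ) : Prop :=
  ∀ t : I, 0 < t → t < 1 → γ t ∉ M.sing ∧
    ∀ c ∈ M.charts, γ t ∈ c.source →
      ∀ᶠ s in 𝓝 t, c (γ s) = c (γ t) + (((s : ℝ) - (t : ℝ) : ℝ) : ℂ) * v

/-- `M.BrokenLine x y L`: there is a finite concatenation of straight line segments from `x` to `y`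
of total length `L`. -/
inductive BrokenLine {X : Type*} [TopologicalSpace X] (M : TranslationStructure X) (x : X) :
    X → ℝ → Prop
  | refl : BrokenLine M x x 0
  | snoc (γ : C(I, X)) (v : ℂ) (L : ℝ) :
      BrokenLine M x (γ 0) L → M.IsSegment γ v → BrokenLine M x (γ 1) (L + ‖v‖)

/-- The flat (length) distance: the infimum of the lengths of broken lines from `x` to `y`. -/
noncomputable def flatEDist {X : Type*} [TopologicalSpace X] (M : TranslationStructure X)
    (x y : X) : ℝ≥0∞ :=
  ⨅ (L : ℝ) (_ : M.BrokenLine x y L), ENNReal.ofReal L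

/-- The ball of radius `R` about `x` for the flat distance. -/
def ball {X : Type*} [TopologicalSpace X] (M : TranslationStructure X) (x : X) (R : ℝ) : Set X :=
  {y | M.flatEDist x y ≤ ENNReal.ofReal R}

/-- The flat area: the least measure that dominates on each chart domain the Lebesgue measure of
the chart. As the charts differ by translations, it coincides with Lebesgue measure in each chart,
and the singular set is a null set. -/
noncomputable def area {X : Type*} [TopologicalSpace X] [MeasurableSpace X]
    (M : TranslationStructure X) : Measure X :=
  ⨆ c ∈ M.charts, Measure.map c.symm (volume.restrict c.target)

/-- The translation structure pulled back by a local homeomorphism `p : E → X`: the singular set is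
the preimage of the singular set, and the charts are the maps `c ∘ p`, with `c` a chart of `X`,
on open sets on which `p` is a homeomorphism onto an open set. -/
def pullback {X E : Type*} [TopologicalSpace X] [TopologicalSpace E] (M : TranslationStructure X)
    (p : E → X) (hp : IsLocalHomeomorph p) : TranslationStructure E where
  sing := p ⁻¹' M.sing
  charts := {φ | ∃ e : OpenPartialHomeomorph E X, ⇑e = p ∧ ∃ c ∈ M.charts, φ = e.trans c}
  source_subset := by
    rintro _ ⟨e, rfl, c, hc, rfl⟩ y hy
    rw [OpenPartialHomeomorph.trans_source] at hy
    exact M.source_subset c hc hy.2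
  covers := by
    intro y hy
    obtain ⟨c, hc, hyc⟩ := M.covers (p y) hy
    obtain ⟨e, hye, rfl⟩ := hp y
    exact ⟨e.trans c, ⟨e, rfl, c, hc, rfl⟩, by
      rw [OpenPartialHomeomorph.trans_source]; exact ⟨hye, hyc⟩⟩
  transition := by
    rintro _ ⟨e, he, c, hc, rfl⟩ _ ⟨e', he', c', hc', rfl⟩ y hy
    simp only [OpenPartialHomeomorph.trans_source, he, he'] at hy
    obtain ⟨v, hv⟩ := M.transition c hc c' hc' (p y) ⟨hy.1.2, hy.2.2⟩
    refine ⟨v, ?_⟩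
    filter_upwards [hp.continuous.continuousAt.eventually hv] with z hz
    simpa [he, he'] using hz
  cone := by
    intro y hy
    obtain ⟨k, hk, ψ, hxψ, hψ0, hψs, hψ⟩ := M.cone (p y) hy
    obtain ⟨e, hye, he⟩ := hp y
    refine ⟨k, hk, e.trans ψ, ?_, ?_, ?_, ?_⟩
    · rw [OpenPartialHomeomorph.trans_source]
      exact ⟨hye, by rw [mem_preimage, ← he]; exact hxψ⟩
    · simpa [← he] using hψ0
    · ext z
      simp only [OpenPartialHomeomorph.trans_source, mem_inter_iff, mem_preimage,
        mem_singleton_iff, ← he]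
      constructor
      · rintro ⟨⟨hz, hzψ⟩, hzs⟩
        have : p z ∈ ψ.source ∩ M.sing := ⟨hzψ, hzs⟩
        rw [hψs] at this
        exact e.injOn hz hye (by rw [← he]; exact this)
      · rintro rfl
        exact ⟨⟨hye, hxψ⟩, hy⟩
    · rintro _ ⟨e', he', c, hc, rfl⟩ z hz
      simp only [OpenPartialHomeomorph.trans_source, he', ← he] at hz
      obtain ⟨N, hN, hd⟩ := hψ c hc (p z) ⟨hz.1.2, hz.2.2⟩
      refine ⟨p ⁻¹' N, hp.continuous.continuousAt hN, fun y₁ h₁ y₂ h₂ => ?_⟩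
      simpa [he', ← he] using hd _ h₁ _ h₂

/-- For a covering `p : E → X`, a point `x` of `E` and `A ⊆ X`: the area of the part of the ball of
radius `R` about `x` in `E` (with the flat structure lifted from `X`) which lies over `A`. -/
noncomputable def liftVolume {X E : Type*} [TopologicalSpace X] [TopologicalSpace E]
    [MeasurableSpace E] (M : TranslationStructure X) (p : E → X) (hp : IsCoveringMap p)
    (A : Set X) (x : E) (R : ℝ) : ℝ≥0∞ :=
  (M.pullback p hp.isLocalHomeomorph).area
    ((M.pullback p hp.isLocalHomeomorph).ball x R ∩ p ⁻¹' A)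

/-- `h` is the (volume) entropy of the surface with universal cover `p : E → X`: the area of the
ball of radius `R` in `E` about any point has exponential growth rate `h`. The logarithm takes
values in the extended reals, with `log 0 = ⊥` and `log ∞ = ⊤`. -/
def IsEntropy {X E : Type*} [TopologicalSpace X] [TopologicalSpace E] [MeasurableSpace E]
    (M : TranslationStructure X) (p : E → X) (hp : IsCoveringMap p) (h : ℝ) : Prop :=
  ∀ x : E, Tendsto
    (fun R : ℝ => ENNReal.log ((M.pullback p hp.isLocalHomeomorph).area
      ((M.pullback p hp.isLocalHomeomorph).ball x R)) / (R : EReal))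
    atTop (𝓝 (h : EReal))

end TranslationStructure

/-! Volume growth is orbit growth. As `E` is simply connected, deck transformations act transitively
on each fibre of `p` (`exists_deck`), and they preserve flat distance and area. Let N(R) count the
points of one fibre within distance R of a base point in it (`fiberCount`). Since `X` is compact,
every point of `E` is within a fixed distance of the fibre. So a ball of radius R is covered by at
most N(R + b) translates of one compact set (`exists_area_ball_le`), while a small piece of positive
area over `A`, lying in one sheet, has N(R) disjoint translates inside a ball only a constant larger
(`exists_le_liftVolume`). Constant factors and shifts do not affect exponential rates, so every V_A
grows like N.

N has a rate because cutting a near-shortest broken line and moving the cut to a nearby fibre point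
gives N(R + S) ≤ N(R + D) N(S + D) (`exists_fiberCount_add_le`); Fekete's lemma applies after a
shift.

The rest is finiteness: balls are relatively compact (`exists_isCompact_ball_subset`) and area is
locally finite (`finiteAt_nhds_area`). Both reduce to local statements in cone charts, where the
flat structure is pulled back by w ↦ w^(k+1). -/

namespace TranslationStructure

/-! ### Broken lines and the flat distance -/

section Metric

variable {E : Type*} [TopologicalSpace E] {T : TranslationStructure E}

/-- The restriction of a segment to the interval between two distinct parameters, affinely
reparametrized, is a segment. -/
lemma IsSegment.reparam {γ : C(I, E)} {v : ℂ} (h : T.IsSegment γ v) {a b : I} (hab : a ≠ b) :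
    ∃ γ' : C(I, E), γ' 0 = γ a ∧ γ' 1 = γ b ∧ T.IsSegment γ' (((b : ℝ) - a : ℝ) * v) := by
  have hmem : ∀ t : I, (a : ℝ) + t * (b - a) ∈ I := fun t => by
    have := a.2.1; have := a.2.2; have := b.2.1; have := b.2.2; have := t.2.1; have := t.2.2
    constructor <;> nlinarith
  let f : C(I, I) := ⟨fun t => ⟨(a : ℝ) + t * (b - a), hmem t⟩, by fun_prop⟩
  refine ⟨γ.comp f, ?_, ?_, fun t ht0 ht1 => ?_⟩
  · simp [f]
  · simp [f]
  · have h0 : (0 : ℝ) < t := ht0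
    have h1 : (t : ℝ) < 1 := ht1
    have hab' : (a : ℝ) ≠ b := fun h => hab (Subtype.ext h)
    have hf : 0 < f t ∧ f t < 1 := by
      have := a.2.1; have := a.2.2; have := b.2.1; have := b.2.2
      change (0 : ℝ) < a + t * (b - a) ∧ (a : ℝ) + t * (b - a) < 1
      rcases lt_or_gt_of_ne hab' with h | h <;> constructor <;> nlinarith
    obtain ⟨hs, hc⟩ := h (f t) hf.1 hf.2
    refine ⟨hs, fun c hcc hsrc => ?_⟩
    filter_upwards [f.continuous.continuousAt.eventually (hc c hcc hsrc)] with s hs'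
    have : ((f s : ℝ) - (f t : ℝ)) = (s - t) * (b - a) := by
      simp only [f, ContinuousMap.coe_mk]; ring
    simp only [ContinuousMap.comp_apply, hs', this]
    push_cast; ring

lemma BrokenLine.nonneg {x y : E} {L : ℝ} (h : T.BrokenLine x y L) : 0 ≤ L := by
  induction h with
  | refl => rfl
  | snoc γ v L _ _ ih => positivity

lemma BrokenLine.trans {x y z : E} {L L' : ℝ} (h : T.BrokenLine x y L)
    (h' : T.BrokenLine y z L') : T.BrokenLine x z (L + L') := by
  induction h' with
  | refl => simpa using h
  | snoc γ v L _ hs ih => rw [← add_assoc]; exact .snoc γ v _ ih hs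

lemma IsSegment.brokenLine {γ : C(I, E)} {v : ℂ} (h : T.IsSegment γ v) (a b : I) :
    T.BrokenLine (γ a) (γ b) (|(b : ℝ) - a| * ‖v‖) := by
  rcases eq_or_ne a b with rfl | hab
  · simpa using BrokenLine.refl
  · obtain ⟨γ', h0, h1, hs⟩ := h.reparam hab
    have := BrokenLine.snoc (M := T) (x := γ' 0) γ' _ 0 .refl hs
    rw [h0, h1] at this
    simpa [-Real.norm_eq_abs, norm_mul, ← Complex.ofReal_sub, Complex.norm_real, Real.norm_eq_abs]
      using this

lemma BrokenLine.symm {x y : E} {L : ℝ} (h : T.BrokenLine x y L) : T.BrokenLine y x L := by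
  induction h with
  | refl => exact .refl
  | snoc γ v L _ hs ih =>
    have := (hs.brokenLine 1 0).trans ih
    simpa [add_comm] using this

/-- Cut the segment along which the accumulated length passes `R`. -/
lemma BrokenLine.exists_split {x y : E} {L : ℝ} (h : T.BrokenLine x y L) {R : ℝ} (h0 : 0 ≤ R)
    (hR : R ≤ L) : ∃ z, T.BrokenLine x z R ∧ T.BrokenLine z y (L - R) := by
  induction h with
  | refl => obtain rfl : R = 0 := le_antisymm hR h0; exact ⟨x, .refl, by simpa using .refl⟩
  | snoc γ v L hb hs ih =>
    rcases le_or_gt R L with h | h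
    · obtain ⟨z, h1, h2⟩ := ih h
      refine ⟨z, h1, ?_⟩
      convert BrokenLine.snoc γ v _ h2 hs using 1
      ring
    · have hv : 0 < ‖v‖ := by linarith
      have ht : (R - L) / ‖v‖ ∈ I :=
        ⟨div_nonneg (by linarith) hv.le, (div_le_one hv).2 (by linarith)⟩
      have e1 : |(R - L) / ‖v‖| = (R - L) / ‖v‖ := abs_of_nonneg ht.1
      have e2 : |1 - (R - L) / ‖v‖| = 1 - (R - L) / ‖v‖ := abs_of_nonneg (by linarith [ht.2])
      refine ⟨γ ⟨_, ht⟩, ?_, ?_⟩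
      · convert hb.trans (hs.brokenLine 0 ⟨_, ht⟩) using 1
        simp only [Icc.coe_zero, sub_zero, e1]
        field_simp; ring
      · convert hs.brokenLine ⟨_, ht⟩ 1 using 1
        simp only [Icc.coe_one, e2]
        field_simp; ring

lemma BrokenLine.flatEDist_le {x y : E} {L : ℝ} (h : T.BrokenLine x y L) :
    T.flatEDist x y ≤ ENNReal.ofReal L := iInf₂_le L h

lemma exists_brokenLine_of_flatEDist_lt {x y : E} {r : ℝ≥0∞} (h : T.flatEDist x y < r) :
    ∃ L, T.BrokenLine x y L ∧ ENNReal.ofReal L < r := by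
  simpa [flatEDist, iInf_lt_iff] using h

lemma flatEDist_self (x : E) : T.flatEDist x x = 0 := by
  simpa using (BrokenLine.refl (M := T) (x := x)).flatEDist_le

lemma flatEDist_comm (x y : E) : T.flatEDist x y = T.flatEDist y x :=
  le_antisymm (le_iInf₂ fun _ h => h.symm.flatEDist_le) (le_iInf₂ fun _ h => h.symm.flatEDist_le)

lemma flatEDist_triangle (x y z : E) : T.flatEDist x z ≤ T.flatEDist x y + T.flatEDist y z :=
  ENNReal.le_iInf₂_add_iInf₂ fun _ h _ h' => by
    rw [← ENNReal.ofReal_add h.nonneg h'.nonneg]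
    exact (h.trans h').flatEDist_le

/-! ### Cone charts and small balls -/

variable (T) in
/-- `ψ` is a chart centred at `y` in which the flat structure is, away from `y`, the pull-back of
the flat structure of `ℂ` by `w ↦ w ^ (k + 1)`. For regular points `k = 0` is possible. -/
structure IsConeChart (ψ : OpenPartialHomeomorph E ℂ) (k : ℕ) (y : E) : Prop where
  mem_source : y ∈ ψ.source
  apply_eq_zero : ψ y = 0
  source_inter_sing : ψ.source ∩ T.sing ⊆ {y}
  exists_isometric : ∀ c ∈ T.charts, ∀ z ∈ ψ.source ∩ c.source, ∃ N ∈ 𝓝 z, ∀ z₁ ∈ N, ∀ z₂ ∈ N,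
    dist (c z₁) (c z₂) = dist (ψ z₁ ^ (k + 1)) (ψ z₂ ^ (k + 1))

-- A regular chart translated to vanish at `y` is a cone chart with `k = 0`, so later local
-- arguments need not separate regular from singular points.
variable (T) in
lemma exists_isConeChart (y : E) : ∃ ψ k, T.IsConeChart ψ k y := by
  by_cases hy : y ∈ T.sing
  · obtain ⟨k, -, ψ, h1, h2, h3, h4⟩ := T.cone y hy
    exact ⟨ψ, k, h1, h2, h3.le, h4⟩
  · obtain ⟨c, hc, hyc⟩ := T.covers y hy
    refine ⟨c.transHomeomorph (Homeomorph.addRight (-c y)), 0, by simpa using hyc, by simp, ?_, ?_⟩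
    · rintro z ⟨hz, hzs⟩
      exact absurd hzs (T.source_subset c hc (by simpa using hz))
    · intro c' hc' z hz
      obtain ⟨v, hv⟩ := T.transition c hc c' hc' z (by simpa using hz)
      exact ⟨_, hv, fun z₁ h₁ z₂ h₂ => by
        simp only [mem_ofPred_eq] at h₁ h₂
        simp [h₁, h₂]⟩

/-- Along a segment which starts well inside a compact disc of a cone chart, the radius in the
cone grows at most by the length of the segment. -/
lemma IsConeChart.norm_segment_le [T2Space E] {ψ : OpenPartialHomeomorph E ℂ} {k : ℕ} {y : E}
    (hψ : T.IsConeChart ψ k y) {ρ : ℝ} (hρ : 0 < ρ) (hρt : Metric.closedBall 0 ρ ⊆ ψ.target)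
    {γ : C(I, E)} {v : ℂ} (hγ : T.IsSegment γ v) {l : ℝ} (h0 : γ 0 ∈ ψ.source)
    (hl : ‖ψ (γ 0)‖ ^ (k + 1) ≤ l) (hlv : l + ‖v‖ < ρ ^ (k + 1)) :
    γ 1 ∈ ψ.source ∧ ‖ψ (γ 1)‖ ^ (k + 1) ≤ l + ‖v‖ := by
  set K : Set E := ψ.symm '' Metric.closedBall 0 ρ with hK
  have hKc : IsClosed K :=
    ((isCompact_closedBall 0 ρ).image_of_continuousOn (ψ.continuousOn_symm.mono hρt)).isClosed
  have hKs : K ⊆ ψ.source := by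
    rintro _ ⟨w, hw, rfl⟩; exact ψ.map_target (hρt hw)
  have hmemK : ∀ z ∈ ψ.source, ‖ψ z‖ ≤ ρ → z ∈ K := fun z hz h =>
    ⟨ψ z, by simpa using h, ψ.left_inv hz⟩
  -- The slack `ε` serves the start: at `t = 0` the path may be at a singular point, where the
  -- segment condition says nothing and only continuity is available.
  have key : ∀ ε > 0, l + ‖v‖ + ε < ρ ^ (k + 1) →
      γ 1 ∈ ψ.source ∧ ‖ψ (γ 1)‖ ^ (k + 1) ≤ l + ‖v‖ + ε := by
    intro ε hε hlt
    let A : Set I := γ ⁻¹' K ∩ {t | ‖ψ (γ t)‖ ^ (k + 1) ≤ l + t * ‖v‖ + ε}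
    have hA : IsClosed A := by
      have hc : ContinuousOn (fun t : I => ‖ψ (γ t)‖ ^ (k + 1) - (l + t * ‖v‖ + ε)) (γ ⁻¹' K) := by
        refine ContinuousOn.sub (ContinuousOn.pow (ContinuousOn.norm ?_) _) (by fun_prop)
        exact ψ.continuousOn.comp γ.continuous.continuousOn (fun t ht => hKs ht)
      have := hc.preimage_isClosed_of_isClosed (hKc.preimage γ.continuous) (isClosed_Iic (a := 0))
      convert this using 1
      ext t; simp [A]
    have hlt' : ∀ t : I, l + t * ‖v‖ + ε < ρ ^ (k + 1) := fun t => by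
      have : (t : ℝ) * ‖v‖ ≤ ‖v‖ := mul_le_of_le_one_left (norm_nonneg _) t.2.2
      linarith
    have hle : ∀ t : I, γ t ∈ ψ.source → ‖ψ (γ t)‖ ^ (k + 1) ≤ l + t * ‖v‖ + ε → t ∈ A :=
      fun t hs ht => ⟨hmemK _ hs (le_of_lt (lt_of_pow_lt_pow_left₀ (k + 1) hρ.le
        (ht.trans_lt (hlt' t)))), ht⟩
    have hsrc : ∀ t : I, γ t ∈ ψ.source → ∀ᶠ s in 𝓝 t, γ s ∈ ψ.source := fun t ht =>
      γ.continuous.continuousAt.eventually (ψ.open_source.mem_nhds ht)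
    have h0A : (0 : I) ∈ A := hle 0 h0 (by simp; linarith)
    have hstep : ∀ t ∈ A, t < 1 → ∀ᶠ s in 𝓝[>] t, s ∈ A := by
      intro t ht ht1
      have hts : γ t ∈ ψ.source := hKs ht.1
      rcases eq_or_lt_of_le (show 0 ≤ t from t.2.1) with rfl | ht0
      · have hc : ContinuousAt (fun s : I => ‖ψ (γ s)‖ ^ (k + 1)) 0 :=
          ((ContinuousAt.comp (g := ψ) (f := γ) (ψ.continuousAt h0)
            γ.continuous.continuousAt).norm).pow _
        have h1 := hc.eventually (gt_mem_nhds (show ‖ψ (γ 0)‖ ^ (k + 1) < l + ε by linarith))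
        filter_upwards [nhdsWithin_le_nhds (hsrc 0 h0), nhdsWithin_le_nhds h1] with s hs h
        refine hle s hs ?_
        have := mul_nonneg s.2.1 (norm_nonneg v)
        linarith
      · obtain ⟨hns, hc⟩ := hγ t ht0 ht1
        obtain ⟨c, hcc, htc⟩ := T.covers _ hns
        obtain ⟨N, hN, hd⟩ := hψ.exists_isometric c hcc _ ⟨hts, htc⟩
        filter_upwards [nhdsWithin_le_nhds (hsrc t hts), nhdsWithin_le_nhds (hc c hcc htc),
          nhdsWithin_le_nhds (γ.continuous.continuousAt.eventually hN), self_mem_nhdsWithin]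
          with s hs h1 h2 h3
        refine hle s hs ?_
        have h4 := hd _ h2 _ (mem_of_mem_nhds hN)
        have hst : (0 : ℝ) ≤ s - t := sub_nonneg.2 (le_of_lt h3)
        rw [h1, dist_self_add_left, norm_mul, Complex.norm_real, Real.norm_of_nonneg hst,
          dist_eq_norm] at h4
        have h5 := norm_sub_norm_le (ψ (γ s) ^ (k + 1)) (ψ (γ t) ^ (k + 1))
        rw [← h4, norm_pow, norm_pow] at h5
        have h6 : ‖ψ (γ t)‖ ^ (k + 1) ≤ l + t * ‖v‖ + ε := ht.2
        linarith
    -- Continuous induction: `A` is closed, contains 0 and extends to the right of each of its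
    -- points before 1.
    have hsub : Icc (0 : I) 1 ⊆ A := by
      refine IsClosed.Icc_subset_of_forall_mem_nhdsWithin (hA.inter isClosed_Icc) h0A ?_
      rintro t ⟨htA, ht⟩
      exact hstep t htA ht.2
    have h1 := hsub (right_mem_Icc.2 zero_le_one)
    exact ⟨hKs h1.1, by simpa using h1.2⟩
  have hpos : 0 < ρ ^ (k + 1) - (l + ‖v‖) := by linarith
  refine ⟨(key _ (half_pos hpos) (by linarith)).1, le_of_forall_pos_le_add fun ε hε => ?_⟩
  refine (key (min ε ((ρ ^ (k + 1) - (l + ‖v‖)) / 2)) (by positivity) ?_).2.trans ?_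
  · linarith [min_le_right ε ((ρ ^ (k + 1) - (l + ‖v‖)) / 2)]
  · linarith [min_le_left ε ((ρ ^ (k + 1) - (l + ‖v‖)) / 2)]

lemma IsConeChart.norm_brokenLine_le [T2Space E] {ψ : OpenPartialHomeomorph E ℂ} {k : ℕ} {y z : E}
    (hψ : T.IsConeChart ψ k y) {ρ : ℝ} (hρ : 0 < ρ) (hρt : Metric.closedBall 0 ρ ⊆ ψ.target)
    {L : ℝ} (h : T.BrokenLine y z L) (hL : L < ρ ^ (k + 1)) :
    z ∈ ψ.source ∧ ‖ψ z‖ ^ (k + 1) ≤ L := by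
  induction h with
  | refl => exact ⟨hψ.mem_source, by simp [hψ.apply_eq_zero]⟩
  | snoc γ v L hb hs ih =>
    obtain ⟨h1, h2⟩ := ih (lt_of_le_of_lt (le_add_of_nonneg_right (norm_nonneg v)) hL)
    exact hψ.norm_segment_le hρ hρt hs h1 h2 hL

/-- Small flat balls are contained in small compact discs of cone charts. -/
lemma IsConeChart.exists_ball_subset [T2Space E] {ψ : OpenPartialHomeomorph E ℂ} {k : ℕ} {y : E}
    (hψ : T.IsConeChart ψ k y) {ρ : ℝ} (hρ : 0 < ρ) (hρt : Metric.closedBall 0 ρ ⊆ ψ.target) :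
    ∃ r > 0, T.ball y r ⊆ ψ.symm '' Metric.closedBall 0 ρ := by
  refine ⟨ρ ^ (k + 1) / 2, by positivity, fun z hz => ?_⟩
  have hlt : T.flatEDist y z < ENNReal.ofReal (ρ ^ (k + 1)) :=
    lt_of_le_of_lt hz ((ENNReal.ofReal_lt_ofReal_iff (by positivity)).2 (half_lt_self (by positivity)))
  obtain ⟨L, hb, hL⟩ := exists_brokenLine_of_flatEDist_lt hlt
  have hL' := (ENNReal.ofReal_lt_ofReal_iff (by positivity)).1 hL
  obtain ⟨h1, h2⟩ := hψ.norm_brokenLine_le hρ hρt hb hL'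
  exact ⟨ψ z, by simpa using le_of_lt (lt_of_pow_lt_pow_left₀ (k + 1) hρ.le (h2.trans_lt hL')),
    ψ.left_inv h1⟩

lemma exists_ball_subset_isCompact [T2Space E] (y : E) :
    ∃ r > 0, ∃ K, IsCompact K ∧ T.ball y r ⊆ K := by
  obtain ⟨ψ, k, hψ⟩ := T.exists_isConeChart y
  obtain ⟨ρ, hρ, hρt⟩ := Metric.nhds_basis_closedBall.mem_iff.1
    (hψ.apply_eq_zero ▸ ψ.open_target.mem_nhds (ψ.map_source hψ.mem_source))
  obtain ⟨r, hr, h⟩ := hψ.exists_ball_subset hρ hρt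
  exact ⟨r, hr, _, (isCompact_closedBall 0 ρ).image_of_continuousOn
    (ψ.continuousOn_symm.mono hρt), h⟩

end Metric
end TranslationStructure

/-! ### Radial segments and finiteness of the distance -/

/-- A locally isometric path in a strictly convex space is locally affine. -/
lemma exists_eventually_eq_of_dist_eq {F : Type*} [NormedAddCommGroup F] [NormedSpace ℝ F]
    [StrictConvexSpace ℝ F] {P : ℝ → F} {t ℓ : ℝ}
    (h : ∃ N ∈ 𝓝 t, ∀ s₁ ∈ N, ∀ s₂ ∈ N, dist (P s₁) (P s₂) = |s₁ - s₂| * ℓ) :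
    ∃ v : F, ‖v‖ = |ℓ| ∧ ∀ᶠ s in 𝓝 t, P s = P t + (s - t) • v := by
  obtain ⟨N, hN, hd⟩ := h
  obtain ⟨η, hη, hball⟩ := Metric.nhds_basis_closedBall.mem_iff.1 hN
  rw [Real.closedBall_eq_Icc] at hball
  have ha : t - η ∈ N := hball ⟨le_rfl, by linarith⟩
  have hb : t + η ∈ N := hball ⟨by linarith, le_rfl⟩
  set w : F := (2 * η)⁻¹ • (P (t + η) - P (t - η)) with hw
  -- Equality in the triangle inequality: `P s` divides the distance between the end values in the
  -- proportion of `s`, so strict convexity puts it on the chord.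
  have key : ∀ s ∈ Icc (t - η) (t + η), P s = P (t - η) + (s - (t - η)) • w := by
    intro s hs
    have := eq_lineMap_of_dist_eq_mul_of_dist_eq_mul (r := (s - (t - η)) / (2 * η))
      (x := P (t - η)) (y := P s) (z := P (t + η)) ?_ ?_
    · rw [this, AffineMap.lineMap_apply, vsub_eq_sub, vadd_eq_add, hw, smul_smul, add_comm,
        div_eq_mul_inv]
    · rw [hd _ ha _ (hball hs), hd _ ha _ hb, abs_of_nonpos (by linarith [hs.1]),
        abs_of_nonpos (by linarith)]
      field_simp; ring
    · rw [hd _ (hball hs) _ hb, hd _ ha _ hb, abs_of_nonpos (by linarith [hs.2]),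
        abs_of_nonpos (by linarith)]
      field_simp; ring
  have ht := key t ⟨by linarith, by linarith⟩
  have hℓ : 0 ≤ ℓ := by
    have := hd _ ha _ hb
    have h2 : 0 < |t - η - (t + η)| := abs_pos.2 (by linarith)
    exact nonneg_of_mul_nonneg_right (this ▸ dist_nonneg) h2
  refine ⟨w, ?_, ?_⟩
  · rw [hw, norm_smul, ← dist_eq_norm, dist_comm, hd _ ha _ hb, Real.norm_of_nonneg (by positivity),
      abs_of_nonpos (by linarith), abs_of_nonneg hℓ]
    field_simp; ring
  · filter_upwards [Icc_mem_nhds (show t - η < t by linarith) (show t < t + η by linarith)] with s hs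
    rw [key s hs, ht, add_assoc, ← add_smul]
    congr 2; ring

namespace TranslationStructure

section Metric

variable {E : Type*} [TopologicalSpace E] {T : TranslationStructure E}

/-- A path which is locally isometric (up to a constant factor `ℓ`) in its interior is a segment. -/
lemma exists_isSegment_of_dist_eq (γ : C(I, E)) (ℓ : ℝ)
    (h : ∀ t : I, 0 < t → t < 1 → ∃ c ∈ T.charts, γ t ∈ c.source ∧
      ∃ N ∈ 𝓝 t, ∀ s₁ ∈ N, ∀ s₂ ∈ N, dist (c (γ s₁)) (c (γ s₂)) = |(s₁ : ℝ) - s₂| * ℓ) :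
    ∃ v, ‖v‖ ≤ |ℓ| ∧ T.IsSegment γ v := by
  let Q : I → ℂ → Prop := fun t v => ∃ c ∈ T.charts, γ t ∈ c.source ∧
    ∀ᶠ s in 𝓝 t, c (γ s) = c (γ t) + (((s : ℝ) - (t : ℝ) : ℝ) : ℂ) * v
  have hQ : ∀ t : I, 0 < t → t < 1 → ∃ v, ‖v‖ = |ℓ| ∧ Q t v := by
    intro t h0 h1
    obtain ⟨c, hc, htc, N, hN, hd⟩ := h t h0 h1
    have hp : ContinuousAt (projIcc (0 : ℝ) 1 zero_le_one) (t : ℝ) := continuous_projIcc.continuousAt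
    have hI : Icc (0 : ℝ) 1 ∈ 𝓝 (t : ℝ) := Icc_mem_nhds h0 h1
    obtain ⟨v, hv, hev⟩ := exists_eventually_eq_of_dist_eq (F := ℂ)
      (P := fun s => c (γ (projIcc 0 1 zero_le_one s))) (t := t) (ℓ := ℓ)
      ⟨projIcc 0 1 zero_le_one ⁻¹' N ∩ Icc 0 1,
        inter_mem (hp (by simpa using hN)) hI, fun s₁ h₁ s₂ h₂ => by
          simpa [projIcc_of_mem zero_le_one h₁.2, projIcc_of_mem zero_le_one h₂.2]
            using hd _ h₁.1 _ h₂.1⟩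
    refine ⟨v, hv, c, hc, htc, ?_⟩
    filter_upwards [continuous_subtype_val.continuousAt.eventually hev] with s hs
    simpa using hs
  have hall : ∀ t v, 0 < t → t < 1 → Q t v → ∀ c ∈ T.charts, γ t ∈ c.source →
      ∀ᶠ s in 𝓝 t, c (γ s) = c (γ t) + (((s : ℝ) - (t : ℝ) : ℝ) : ℂ) * v := by
    rintro t v - - ⟨c, hc, htc, hev⟩ c' hc' htc'
    obtain ⟨b, hb⟩ := T.transition c hc c' hc' (γ t) ⟨htc, htc'⟩
    have hb' := γ.continuous.continuousAt.eventually hb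
    filter_upwards [hb', hev] with s h1 h2
    rw [h1, h2, hb'.self_of_nhds]; ring
  have huniq : ∀ t v w, 0 < t → t < 1 → Q t v → Q t w → v = w := by
    intro t v w h0 h1 hv hw
    obtain ⟨c, hc, htc, hev⟩ := id hw
    have hne : (𝓝[>] t).NeBot := nhdsGT_neBot_of_exists_gt ⟨1, h1⟩
    have hall' := ((hall t v h0 h1 hv c hc htc).and hev).filter_mono
      (nhdsWithin_le_nhds (s := Ioi t))
    obtain ⟨s, ⟨hs1, hs2⟩, hs⟩ := (hall'.and self_mem_nhdsWithin).exists
    have hne' : (((s : ℝ) - (t : ℝ) : ℝ) : ℂ) ≠ 0 :=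
      Complex.ofReal_ne_zero.2 (sub_pos.2 (show (t : ℝ) < s from hs)).ne'
    exact mul_left_cancel₀ hne' (add_left_cancel (hs1.symm.trans hs2))
  have hopen : ∀ t v, 0 < t → t < 1 → Q t v → ∀ᶠ s in 𝓝 t, Q s v := by
    rintro t v - - ⟨c, hc, htc, hev⟩
    filter_upwards [hev.eventually_nhds,
      γ.continuous.continuousAt.eventually (c.open_source.mem_nhds htc)] with s hs hsc
    refine ⟨c, hc, hsc, ?_⟩
    filter_upwards [hs] with u hu
    rw [hu, hs.self_of_nhds]; push_cast; ring
  choose! V hV hVQ using hQ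
  have : PreconnectedSpace (Ioo (0 : I) 1) :=
    isPreconnected_iff_preconnectedSpace.1 isPreconnected_Ioo
  -- The local velocity is unique and persists nearby, so on the connected open interval a single
  -- vector serves all parameters.
  have hlc : IsLocallyConstant fun t : Ioo (0 : I) 1 => V t := by
    refine (IsLocallyConstant.iff_eventually_eq _).2 fun t => ?_
    filter_upwards [continuous_subtype_val.continuousAt.eventually
      (hopen t _ t.2.1 t.2.2 (hVQ t t.2.1 t.2.2))] with s hs
    exact huniq s _ _ s.2.1 s.2.2 (hVQ s s.2.1 s.2.2) hs
  have hm : (⟨1 / 2, by norm_num, by norm_num⟩ : I) ∈ Ioo (0 : I) 1 :=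
    ⟨by rw [← Subtype.coe_lt_coe]; norm_num, by rw [← Subtype.coe_lt_coe]; norm_num⟩
  refine ⟨V ⟨1 / 2, by norm_num, by norm_num⟩, (hV _ hm.1 hm.2).le, fun t h0 h1 => ⟨?_, ?_⟩⟩
  · obtain ⟨c, hc, htc, -⟩ := h t h0 h1
    exact T.source_subset c hc htc
  · have := hlc.apply_eq_of_preconnectedSpace ⟨t, h0, h1⟩ ⟨_, hm⟩
    exact hall t _ h0 h1 (this ▸ hVQ t h0 h1)

/-- The radius from the apex to `z`, parametrized as `t ^ (1 / (k + 1)) * ψ z`, has `(k + 1)`-st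
power linear in `t`; hence it is a segment. -/
lemma IsConeChart.exists_brokenLine {ψ : OpenPartialHomeomorph E ℂ} {k : ℕ} {y : E}
    (hψ : T.IsConeChart ψ k y) {ρ : ℝ} (hρt : Metric.closedBall 0 ρ ⊆ ψ.target) {z : E}
    (hz : z ∈ ψ.source) (hzρ : ‖ψ z‖ ≤ ρ) : ∃ L ≤ ‖ψ z‖ ^ (k + 1), T.BrokenLine y z L := by
  rcases eq_or_ne (ψ z) 0 with h0 | h0
  · obtain rfl : z = y := ψ.injOn hz hψ.mem_source (h0.trans hψ.apply_eq_zero.symm)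
    exact ⟨0, by positivity, .refl⟩
  let g : I → ℂ := fun t => (((t : ℝ) ^ ((k + 1 : ℕ) : ℝ)⁻¹ : ℝ) : ℂ) * ψ z
  have hroot : ∀ t : I, ((t : ℝ) ^ ((k + 1 : ℕ) : ℝ)⁻¹) ^ (k + 1) = t := fun t =>
    Real.rpow_inv_natCast_pow t.2.1 (Nat.succ_ne_zero k)
  have hg : Continuous g := by
    refine (Complex.continuous_ofReal.comp ?_).mul continuous_const
    exact continuous_subtype_val.rpow_const fun _ => .inr (by positivity)
  have hgt : ∀ t, g t ∈ ψ.target := fun t => hρt <| by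
    have h1 : (t : ℝ) ^ ((k + 1 : ℕ) : ℝ)⁻¹ ≤ 1 := Real.rpow_le_one t.2.1 t.2.2 (by positivity)
    have h2 : 0 ≤ (t : ℝ) ^ ((k + 1 : ℕ) : ℝ)⁻¹ := Real.rpow_nonneg t.2.1 _
    rw [mem_closedBall_zero_iff, norm_mul, Complex.norm_real, Real.norm_of_nonneg h2]
    exact (mul_le_of_le_one_left (norm_nonneg _) h1).trans hzρ
  have hgp : ∀ t, g t ^ (k + 1) = ((t : ℝ) : ℂ) * ψ z ^ (k + 1) := fun t => by
    rw [mul_pow, ← Complex.ofReal_pow, hroot]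
  let γ : C(I, E) := ⟨fun t => ψ.symm (g t), ψ.continuousOn_symm.comp_continuous hg hgt⟩
  have hψγ : ∀ t, ψ (γ t) = g t := fun t => ψ.right_inv (hgt t)
  obtain ⟨v, hv, hs⟩ := T.exists_isSegment_of_dist_eq γ (‖ψ z‖ ^ (k + 1)) <| by
    intro t ht0 ht1
    have hsrc : γ t ∈ ψ.source := ψ.map_target (hgt t)
    have hns : γ t ∉ T.sing := fun hsing => by
      have h1 : γ t = y := hψ.source_inter_sing ⟨hsrc, hsing⟩
      have h2 : g t ^ (k + 1) = 0 := by rw [← hψγ, h1, hψ.apply_eq_zero]; simp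
      rw [hgp] at h2
      have ht : (0 : ℝ) < t := ht0
      simp [h0, ht.ne'] at h2
    obtain ⟨c, hc, htc⟩ := T.covers _ hns
    obtain ⟨N, hN, hd⟩ := hψ.exists_isometric c hc _ ⟨hsrc, htc⟩
    refine ⟨c, hc, htc, γ ⁻¹' N, γ.continuous.continuousAt hN, fun s₁ h₁ s₂ h₂ => ?_⟩
    rw [hd _ h₁ _ h₂, hψγ, hψγ, hgp, hgp, dist_eq_norm, ← sub_mul, norm_mul, norm_pow,
      ← Complex.ofReal_sub, Complex.norm_real, Real.norm_eq_abs]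
  have hb := hs.brokenLine 0 1
  have e0 : γ 0 = y := by
    have : g 0 = 0 := by simp [g, Real.zero_rpow (inv_ne_zero (by positivity : (k : ℝ) + 1 ≠ 0))]
    rw [← ψ.left_inv hψ.mem_source, hψ.apply_eq_zero]
    simp [γ, this]
  have e1 : γ 1 = z := by simp [γ, g, hz]
  rw [e0, e1] at hb
  refine ⟨_, ?_, hb⟩
  rw [abs_of_nonneg (by positivity)] at hv
  simpa using hv

/-- Flat balls are neighbourhoods of their centres. -/
lemma ball_mem_nhds (y : E) {r : ℝ} (hr : 0 < r) : T.ball y r ∈ 𝓝 y := by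
  obtain ⟨ψ, k, hψ⟩ := T.exists_isConeChart y
  obtain ⟨ρ, hρ, hρt⟩ := Metric.nhds_basis_closedBall.mem_iff.1
    (hψ.apply_eq_zero ▸ ψ.open_target.mem_nhds (ψ.map_source hψ.mem_source))
  have hc : ContinuousAt (fun z => ‖ψ z‖) y := (ψ.continuousAt hψ.mem_source).norm
  have h1 : ∀ᶠ z in 𝓝 y, ‖ψ z‖ < ρ := hc.eventually (gt_mem_nhds (by simpa [hψ.apply_eq_zero]))
  have h2 : ∀ᶠ z in 𝓝 y, ‖ψ z‖ ^ (k + 1) < r :=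
    (hc.pow (k + 1)).eventually (gt_mem_nhds (by simpa [hψ.apply_eq_zero]))
  filter_upwards [h1, h2, ψ.open_source.mem_nhds hψ.mem_source] with z hz1 hz2 hz3
  obtain ⟨L, hL, hb⟩ := hψ.exists_brokenLine hρt hz3 hz1.le
  exact hb.flatEDist_le.trans (ENNReal.ofReal_le_ofReal (hL.trans hz2.le))

/-- Unit balls are neighbourhoods of their centres, so the points at finite distance from `x` form a
clopen set. -/
lemma flatEDist_lt_top [PreconnectedSpace E] (x y : E) : T.flatEDist x y < ⊤ := by
  have hball : ∀ z, T.ball z 1 ∈ 𝓝 z := fun z => T.ball_mem_nhds z one_pos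
  have hfin : ∀ z, ∀ w ∈ T.ball z 1, T.flatEDist z w < ⊤ := fun z w hw =>
    lt_of_le_of_lt hw ENNReal.ofReal_lt_top
  have hclopen : IsClopen {z | T.flatEDist x z < ⊤} := by
    constructor
    · refine isOpen_compl_iff.1 (isOpen_iff_mem_nhds.2 fun z hz => ?_)
      filter_upwards [hball z] with w hw hxw
      refine hz ((T.flatEDist_triangle x w z).trans_lt (ENNReal.add_lt_top.2 ⟨hxw, ?_⟩))
      rw [T.flatEDist_comm]; exact hfin z w hw
    · refine isOpen_iff_mem_nhds.2 fun z hz => ?_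
      filter_upwards [hball z] with w hw
      exact (T.flatEDist_triangle x z w).trans_lt (ENNReal.add_lt_top.2 ⟨hz, hfin z w hw⟩)
  have := hclopen.eq_univ ⟨x, by simp [T.flatEDist_self]⟩
  exact (this ▸ mem_univ y : y ∈ {z | T.flatEDist x z < ⊤})

/-- The loss `δ` is there because the infimum defining the distance need not be attained. -/
lemma exists_flatEDist_le_of_le_add {x y : E} {R S δ : ℝ} (hR : 0 ≤ R) (hS : 0 ≤ S) (hδ : 0 < δ)
    (h : T.flatEDist x y ≤ ENNReal.ofReal (R + S)) :
    ∃ z, T.flatEDist x z ≤ ENNReal.ofReal R ∧ T.flatEDist z y ≤ ENNReal.ofReal (S + δ) := by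
  have hlt : T.flatEDist x y < ENNReal.ofReal (R + S + δ) :=
    lt_of_le_of_lt h ((ENNReal.ofReal_lt_ofReal_iff (by positivity)).2 (by linarith))
  obtain ⟨L, hb, hL⟩ := exists_brokenLine_of_flatEDist_lt hlt
  have hL' := (ENNReal.ofReal_lt_ofReal_iff (by positivity)).1 hL
  rcases le_total R L with hRL | hRL
  · obtain ⟨z, h1, h2⟩ := hb.exists_split hR hRL
    exact ⟨z, h1.flatEDist_le, h2.flatEDist_le.trans (ENNReal.ofReal_le_ofReal (by linarith))⟩
  · exact ⟨y, hb.flatEDist_le.trans (ENNReal.ofReal_le_ofReal hRL), by simp [T.flatEDist_self]⟩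

lemma flatEDist_le_ofReal_add {x y z : E} {R S : ℝ} (hR : 0 ≤ R) (hS : 0 ≤ S)
    (h₁ : T.flatEDist x y ≤ ENNReal.ofReal R) (h₂ : T.flatEDist y z ≤ ENNReal.ofReal S) :
    T.flatEDist x z ≤ ENNReal.ofReal (R + S) := by
  rw [ENNReal.ofReal_add hR hS]
  exact (T.flatEDist_triangle x y z).trans (add_le_add h₁ h₂)

end Metric
end TranslationStructure

/-! ### The flat area -/

/-- A locally `K`-Lipschitz map of a finite-dimensional normed space multiplies the Haar measure of
a set at most by `K ^ finrank ℝ F`. -/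
lemma MeasureTheory.Measure.addHaar_image_le_of_locally_lipschitzOnWith {F : Type*}
    [NormedAddCommGroup F] [NormedSpace ℝ F] [FiniteDimensional ℝ F] [MeasurableSpace F]
    [BorelSpace F] (μ : Measure F) [μ.IsAddHaarMeasure] {g : F → F} {K : NNReal} {s : Set F}
    (h : ∀ x ∈ s, ∃ u ∈ 𝓝[s] x, LipschitzOnWith K g u) :
    μ (g '' s) ≤ (K : ℝ≥0∞) ^ Module.finrank ℝ F * μ s := by
  -- Haar measure is a multiple of Hausdorff measure, for which the Lipschitz bound is known.
  have hlip : ∀ u, LipschitzOnWith K g u →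
      μ (g '' u) ≤ (K : ℝ≥0∞) ^ Module.finrank ℝ F * μ u := fun u hu => by
    rw [Measure.isAddLeftInvariant_eq_smul μ μH[Module.finrank ℝ F], Measure.smul_apply,
      Measure.smul_apply, ENNReal.smul_def, ENNReal.smul_def, smul_eq_mul, smul_eq_mul,
      mul_left_comm]
    gcongr
    simpa using hu.hausdorffMeasure_image_le (Nat.cast_nonneg (Module.finrank ℝ F))
  choose! u hu hLip using h
  have h2 : ∀ x ∈ s, ∃ O, IsOpen O ∧ x ∈ O ∧ O ∩ s ⊆ u x := fun x hx =>
    mem_nhdsWithin.1 (hu x hx)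
  choose! O hO hxO hOu using h2
  obtain ⟨t, hts, htc, hst⟩ := TopologicalSpace.countable_cover_nhdsWithin
    (f := O) (s := s) fun x hx => nhdsWithin_le_nhds ((hO x hx).mem_nhds (hxO x hx))
  rcases s.eq_empty_or_nonempty with rfl | hne
  · simp
  have htne : t.Nonempty := by
    obtain ⟨x, hx⟩ := hne
    obtain ⟨i, hi, -⟩ := mem_iUnion₂.1 (hst hx)
    exact ⟨i, hi⟩
  obtain ⟨e, rfl⟩ := htc.exists_eq_range htne
  have he : ∀ n, e n ∈ s := fun n => hts ⟨n, rfl⟩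
  -- `s` need not be measurable; measurable disjoint pieces, weighed by `μ.restrict s`, still add up
  -- to at most `μ s`.
  set D : ℕ → Set F := disjointed fun n => O (e n)
  have hDm : ∀ n, MeasurableSet (D n) := MeasurableSet.disjointed fun n => (hO _ (he n)).measurableSet
  have hcov : s ⊆ ⋃ n, D n := by
    rw [iUnion_disjointed]; simpa using hst
  calc μ (g '' s) ≤ μ (⋃ n, g '' (D n ∩ s)) := by
        refine measure_mono ?_
        rw [← image_iUnion, ← iUnion_inter]
        exact image_mono fun x hx => ⟨hcov hx, hx⟩
    _ ≤ ∑' n, μ (g '' (D n ∩ s)) := measure_iUnion_le _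
    _ ≤ ∑' n, (K : ℝ≥0∞) ^ Module.finrank ℝ F * μ.restrict s (D n) := by
        refine ENNReal.tsum_le_tsum fun n => ?_
        rw [Measure.restrict_apply (hDm n)]
        exact hlip _ ((hLip _ (he n)).mono
          ((inter_subset_inter_left _ (disjointed_subset _ n)).trans (hOu _ (he n))))
    _ = (K : ℝ≥0∞) ^ Module.finrank ℝ F * μ.restrict s (⋃ n, D n) := by
        rw [ENNReal.tsum_mul_left, measure_iUnion (disjoint_disjointed _) hDm]
    _ ≤ _ := mul_le_mul' le_rfl
        ((measure_mono (subset_univ _)).trans_eq (Measure.restrict_apply_univ s))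

namespace TranslationStructure

section Area

variable {E : Type*} [TopologicalSpace E] [MeasurableSpace E] [BorelSpace E]
  {T : TranslationStructure E}

lemma _root_.OpenPartialHomeomorph.map_symm_restrict_apply
    (c : OpenPartialHomeomorph E ℂ) {t : Set ℂ} (ht : MeasurableSet t) (htc : t ⊆ c.target)
    {s : Set E} (hs : MeasurableSet s) :
    Measure.map c.symm (volume.restrict t) s = volume (c.symm ⁻¹' s ∩ t) := by
  have hm : AEMeasurable c.symm (volume.restrict t) :=
    (c.continuousOn_symm.mono htc).aemeasurable ht
  rw [Measure.map_apply_of_aemeasurable hm hs, Measure.restrict_apply' ht]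

lemma le_area {c : OpenPartialHomeomorph E ℂ} (hc : c ∈ T.charts) {s : Set E}
    (hs : MeasurableSet s) : volume (c.symm ⁻¹' s ∩ c.target) ≤ T.area s := by
  rw [← c.map_symm_restrict_apply c.open_target.measurableSet subset_rfl hs]
  exact le_iSup₂ (f := fun c (_ : c ∈ T.charts) => Measure.map c.symm (volume.restrict c.target))
    c hc s

lemma area_le {ν : Measure E} (h : ∀ c ∈ T.charts, ∀ s, MeasurableSet s →
    volume (c.symm ⁻¹' s ∩ c.target) ≤ ν s) : T.area ≤ ν :=
  iSup₂_le fun c hc => Measure.le_iff.2 fun s hs => by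
    rw [c.map_symm_restrict_apply c.open_target.measurableSet subset_rfl hs]
    exact h c hc s hs

lemma area_univ_pos [Nonempty E] : 0 < T.area univ := by
  obtain ⟨y⟩ := ‹Nonempty E›
  obtain ⟨c, hc, z, hz⟩ : ∃ c ∈ T.charts, c.source.Nonempty := by
    obtain ⟨ψ, k, hψ⟩ := T.exists_isConeChart y
    have hmem : (0 : ℂ) ∈ ψ.target := hψ.apply_eq_zero ▸ ψ.map_source hψ.mem_source
    obtain ⟨w, hw0, hw⟩ := (dense_compl_singleton (0 : ℂ)).inter_open_nonempty _ ψ.open_target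
      ⟨0, hmem⟩
    have hns : ψ.symm w ∉ T.sing := fun hs => by
      have h1 : ψ.symm w = y := hψ.source_inter_sing ⟨ψ.map_target hw0, hs⟩
      exact hw (by rw [mem_singleton_iff, ← ψ.right_inv hw0, h1, hψ.apply_eq_zero])
    obtain ⟨c, hc, hwc⟩ := T.covers _ hns
    exact ⟨c, hc, _, hwc⟩
  refine lt_of_lt_of_le ?_ (le_area hc MeasurableSet.univ)
  rw [preimage_univ, univ_inter]
  exact c.open_target.measure_pos volume ⟨c z, c.map_source hz⟩

/-- By minimality of the area: if `A` were null in every chart, the area restricted to `Aᶜ` would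
still dominate every chart, so `A` would be null. -/
lemma exists_chart_of_area_pos {A : Set E} (hA : MeasurableSet A) (h : 0 < T.area A) :
    ∃ c ∈ T.charts, 0 < volume (c.symm ⁻¹' A ∩ c.target) := by
  by_contra! hcon
  have : T.area ≤ T.area.restrict Aᶜ := T.area_le fun c hc s hs => by
    rw [Measure.restrict_apply hs]
    calc volume (c.symm ⁻¹' s ∩ c.target)
        ≤ volume ((c.symm ⁻¹' (s ∩ Aᶜ) ∩ c.target) ∪ (c.symm ⁻¹' A ∩ c.target)) := by
          refine measure_mono fun w hw => ?_
          by_cases h : c.symm w ∈ A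
          · exact .inr ⟨h, hw.2⟩
          · exact .inl ⟨⟨hw.1, h⟩, hw.2⟩
      _ ≤ volume (c.symm ⁻¹' (s ∩ Aᶜ) ∩ c.target) + 0 :=
          (measure_union_le _ _).trans (add_le_add le_rfl (hcon c hc))
      _ ≤ T.area (s ∩ Aᶜ) := by
          rw [add_zero]; exact T.le_area hc (hs.inter hA.compl)
  have h0 := this A
  rw [Measure.restrict_apply hA] at h0
  simp at h0
  exact h.ne' h0

/-- The flat area is locally finite. -/
lemma finiteAt_nhds_area (y : E) : T.area.FiniteAtFilter (𝓝 y) := by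
  obtain ⟨ψ, k, hψ⟩ := T.exists_isConeChart y
  obtain ⟨K, t, ht, hK⟩ : ∃ K, ∃ t ∈ 𝓝 (0 : ℂ), LipschitzOnWith K (fun w : ℂ => w ^ (k + 1)) t :=
    (contDiff_id.pow (k + 1)).contDiffAt.exists_lipschitzOnWith (𝕂 := ℂ)
  obtain ⟨ρ, hρ, hρt⟩ := Metric.nhds_basis_ball.mem_iff.1 (inter_mem ht
    (hψ.apply_eq_zero ▸ ψ.open_target.mem_nhds (ψ.map_source hψ.mem_source)))
  have hBt : Metric.ball (0 : ℂ) ρ ⊆ ψ.target := fun w hw => (hρt hw).2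
  have hBm : MeasurableSet (Metric.ball (0 : ℂ) ρ) := Metric.isOpen_ball.measurableSet
  set V : Set E := ψ.source ∩ ψ ⁻¹' Metric.ball 0 ρ
  have hV : IsOpen V := ψ.isOpen_inter_preimage Metric.isOpen_ball
  -- Minimality compares measures on all of `E`, so the bound wanted on `V` is extended by infinite
  -- mass at every point outside `V`.
  set ν : Measure E := ((K : ℝ≥0∞) ^ 2) • Measure.map ψ.symm (volume.restrict (Metric.ball 0 ρ)) +
    (⊤ : ℝ≥0∞) • Measure.count.restrict Vᶜ
  have hν : ∀ s, MeasurableSet s → ν s = (K : ℝ≥0∞) ^ 2 * volume (ψ.symm ⁻¹' s ∩ Metric.ball 0 ρ) +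
      ⊤ * Measure.count (s ∩ Vᶜ) := fun s hs => by
    simp only [ν, Measure.add_apply, Measure.smul_apply, smul_eq_mul,
      ψ.map_symm_restrict_apply hBm hBt hs, Measure.restrict_apply hs]
  have hle : T.area ≤ ν := T.area_le fun c hc s hs => by
    rw [hν s hs]
    by_cases hsV : s ⊆ V
    · refine le_trans ?_ le_self_add
      set B : Set ℂ := ψ.symm ⁻¹' (s ∩ c.source) ∩ Metric.ball 0 ρ
      have h1 : c.symm ⁻¹' s ∩ c.target ⊆ (c ∘ ψ.symm) '' B := by
        rintro u ⟨hu, hut⟩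
        have hz := hsV hu
        refine ⟨ψ (c.symm u), ⟨?_, hz.2⟩, ?_⟩
        · simpa [ψ.left_inv hz.1] using ⟨hu, c.map_target hut⟩
        · simp [ψ.left_inv hz.1, c.right_inv hut]
      have h2 : volume ((c ∘ ψ.symm) '' B) ≤ (K : ℝ≥0∞) ^ 2 * volume B := by
        have := Measure.addHaar_image_le_of_locally_lipschitzOnWith (volume : Measure ℂ)
          (g := c ∘ ψ.symm) (K := K) (s := B) ?_
        · simpa using this
        rintro w ⟨⟨-, hwc⟩, hw⟩
        obtain ⟨N, hN, hd⟩ := hψ.exists_isometric c hc (ψ.symm w) ⟨ψ.map_target (hBt hw), hwc⟩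
        refine ⟨ψ.symm ⁻¹' N ∩ Metric.ball 0 ρ, nhdsWithin_le_nhds (inter_mem
          (ψ.symm.continuousAt (hBt hw) hN) (Metric.isOpen_ball.mem_nhds hw)), ?_⟩
        refine LipschitzOnWith.of_dist_le_mul fun w₁ h₁ w₂ h₂ => ?_
        rw [Function.comp_apply, Function.comp_apply, hd _ h₁.1 _ h₂.1, ψ.right_inv (hBt h₁.2),
          ψ.right_inv (hBt h₂.2)]
        exact hK.dist_le_mul _ (hρt h₁.2).1 _ (hρt h₂.2).1
      refine (measure_mono h1).trans (h2.trans ?_)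
      gcongr
      exact fun w hw => ⟨hw.1.1, hw.2⟩
    · obtain ⟨z, hz, hzV⟩ := not_subset.1 hsV
      have : Measure.count (s ∩ Vᶜ) ≠ 0 := by
        rw [Ne, Measure.count_eq_zero_iff]
        exact nonempty_iff_ne_empty.1 ⟨z, hz, hzV⟩
      rw [ENNReal.top_mul this, add_top]
      exact le_top
  refine ⟨V, hV.mem_nhds ⟨hψ.mem_source, by simpa [hψ.apply_eq_zero]⟩, (hle V).trans_lt ?_⟩
  rw [hν V hV.measurableSet]
  simp only [inter_compl_self, measure_empty, mul_zero, add_zero]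
  refine ENNReal.mul_lt_top (by simp) ?_
  exact (measure_mono inter_subset_right).trans_lt measure_ball_lt_top

lemma area_lt_top_of_isCompact {K : Set E} (hK : IsCompact K) : T.area K < ⊤ :=
  hK.measure_lt_top_of_nhdsWithin fun y _ => (T.finiteAt_nhds_area y).filter_mono nhdsWithin_le_nhds

end Area
end TranslationStructure

/-! ### Coverings and deck transformations -/

lemma IsCoveringMap.t2Space {X E : Type*} [TopologicalSpace X] [T2Space X] [TopologicalSpace E]
    {p : E → X} (hp : IsCoveringMap p) : T2Space E := by
  refine ⟨fun x y hxy => ?_⟩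
  by_cases h : p x = p y
  · exact hp.isSeparatedMap x y h hxy
  · obtain ⟨u, v, hu, hv, hxu, hyv, huv⟩ := t2_separation h
    exact ⟨p ⁻¹' u, p ⁻¹' v, hu.preimage hp.continuous, hv.preimage hp.continuous, hxu, hyv,
      huv.preimage p⟩

lemma IsCoveringMap.surjective_of_connected {X E : Type*} [TopologicalSpace X] [PreconnectedSpace X]
    [TopologicalSpace E] [Nonempty E] {p : E → X} (hp : IsCoveringMap p) :
    Function.Surjective p := by
  have hclosed : IsClosed (range p) := by
    refine isOpen_compl_iff.1 (isOpen_iff_mem_nhds.2 fun x hx => ?_)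
    obtain ⟨-, U, hxU, hU, -, H, hH⟩ := hp x
    filter_upwards [hU.mem_nhds hxU]
    rintro _ hy ⟨z, rfl⟩
    refine hx ⟨(H.symm (⟨x, hxU⟩, (H ⟨z, hy⟩).2) : p ⁻¹' U), ?_⟩
    rw [← hH]; simp
  exact range_eq_univ.1 (IsClopen.eq_univ ⟨hclosed, hp.isOpenMap.isOpen_range⟩ (range_nonempty p))

namespace TranslationStructure

/-- Needed for the lifting criterion in `exists_deck`. -/
lemma locallyPathConnectedSpace {E : Type*} [TopologicalSpace E] (T : TranslationStructure E) :
    LocallyPathConnectedSpace E := by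
  choose ψ k hψ using T.exists_isConeChart
  let _ : ChartedSpace ℂ E :=
    { atlas := range ψ
      chartAt := ψ
      mem_chart_source := fun y => (hψ y).mem_source
      chart_mem_atlas := fun y => ⟨y, rfl⟩ }
  exact ChartedSpace.locallyPathConnectedSpace ℂ E

section Covering

variable {X E : Type*} [TopologicalSpace X] [TopologicalSpace E] {M : TranslationStructure X}
  {p : E → X} {hp : IsLocalHomeomorph p}

lemma IsSegment.comp_deck {γ : C(I, E)} {v : ℂ} (h : (M.pullback p hp).IsSegment γ v) (φ : C(E, E))
    (hφ : ∀ x, p (φ x) = p x) : (M.pullback p hp).IsSegment (φ.comp γ) v := by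
  intro t h0 h1
  obtain ⟨hs, hc⟩ := h t h0 h1
  refine ⟨by simpa [pullback, hφ] using hs, ?_⟩
  rintro _ ⟨e, he, c, hcM, rfl⟩ ht
  obtain ⟨e', he't, he'⟩ := hp (γ t)
  have hpt : p (γ t) ∈ c.source := by
    have := ht.2
    simpa [he, hφ] using this
  have := hc (e'.trans c) ⟨e', he'.symm, c, hcM, rfl⟩ ⟨he't, by simpa [← he'] using hpt⟩
  simpa [he, ← he', hφ] using this

lemma BrokenLine.comp_deck {x y : E} {L : ℝ} (h : (M.pullback p hp).BrokenLine x y L) (φ : C(E, E))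
    (hφ : ∀ x, p (φ x) = p x) : (M.pullback p hp).BrokenLine (φ x) (φ y) L := by
  induction h with
  | refl => exact .refl
  | snoc γ v L _ hs ih => exact .snoc (φ.comp γ) v L ih (hs.comp_deck φ hφ)

lemma flatEDist_deck (φ : E ≃ₜ E) (hφ : ∀ x, p (φ x) = p x) (x y : E) :
    (M.pullback p hp).flatEDist (φ x) (φ y) = (M.pullback p hp).flatEDist x y := by
  refine le_antisymm (le_iInf₂ fun L h => (h.comp_deck (φ : C(E, E)) hφ).flatEDist_le)
    (le_iInf₂ fun L h => ?_)
  have := (h.comp_deck (φ.symm : C(E, E)) fun z => by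
    have := hφ (φ.symm z); simpa using this.symm).flatEDist_le
  simpa using this

/-- `φ` followed by a chart is again a chart, so the push-forward of the area by `φ` dominates every
chart and hence, by minimality, the area. -/
lemma area_le_area_preimage_deck [MeasurableSpace E] [BorelSpace E] (φ : E ≃ₜ E)
    (hφ : ∀ x, p (φ x) = p x) {s : Set E} (hs : MeasurableSet s) :
    (M.pullback p hp).area s ≤ (M.pullback p hp).area (φ ⁻¹' s) := by
  rw [← Measure.map_apply φ.measurable hs]
  refine (area_le ?_ : _ ≤ Measure.map φ _) s
  rintro _ ⟨e, he, c, hcM, rfl⟩ s hs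
  rw [Measure.map_apply φ.measurable hs]
  have := le_area (T := M.pullback p hp) (c := (φ.toOpenPartialHomeomorph.trans e).trans c)
    ⟨_, by ext; simp [he, hφ], c, hcM, rfl⟩ (hs.preimage φ.measurable)
  convert this using 2
  ext w
  simp

lemma area_image_deck [MeasurableSpace E] [BorelSpace E] (φ : E ≃ₜ E)
    (hφ : ∀ x, p (φ x) = p x) {s : Set E} (hs : MeasurableSet s) :
    (M.pullback p hp).area (φ '' s) = (M.pullback p hp).area s := by
  have hm : MeasurableSet (φ '' s) := φ.toMeasurableEquiv.measurableSet_image.2 hs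
  have h1 := area_le_area_preimage_deck (M := M) (hp := hp) φ hφ hm
  have h2 := area_le_area_preimage_deck (M := M) (hp := hp) φ.symm (fun z => by
    have := hφ (φ.symm z); simpa using this.symm) hs
  rw [preimage_image_eq _ φ.injective] at h1
  rw [← φ.image_eq_preimage_symm] at h2
  exact le_antisymm h1 h2

/-- The deck transformations of a simply connected covering act transitively on the fibres. -/
lemma exists_deck [SimplyConnectedSpace E] (M : TranslationStructure X) (hp : IsCoveringMap p)
    {x y : E} (h : p x = p y) : ∃ φ : E ≃ₜ E, (∀ z, p (φ z) = p z) ∧ φ x = y := by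
  have := (M.pullback p hp.isLocalHomeomorph).locallyPathConnectedSpace
  -- Lift `p` through itself with `x ↦ y` and with `y ↦ x`; the composites lift `p` and fix a point,
  -- so they are the identity.
  obtain ⟨F, ⟨hFx, hF⟩, -⟩ := hp.existsUnique_continuousMap_lifts ⟨p, hp.continuous⟩ x y h.symm
  obtain ⟨G, ⟨hGy, hG⟩, -⟩ := hp.existsUnique_continuousMap_lifts ⟨p, hp.continuous⟩ y x h
  have hF' : ∀ z, p (F z) = p z := fun z => congrFun hF z
  have hG' : ∀ z, p (G z) = p z := fun z => congrFun hG z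
  have hGF : G ∘ F = id := hp.eq_of_comp_eq (G.continuous.comp F.continuous) continuous_id
    (by ext z; simp [hF', hG']) x (by simp [hFx, hGy])
  have hFG : F ∘ G = id := hp.eq_of_comp_eq (F.continuous.comp G.continuous) continuous_id
    (by ext z; simp [hF', hG']) y (by simp [hFx, hGy])
  exact ⟨⟨⟨F, G, congrFun hGF, congrFun hFG⟩, F.continuous, G.continuous⟩, hF', hFx⟩

end Covering

end TranslationStructure

/-! ### Cocompactness: compact balls and counting in fibres -/

namespace TranslationStructure

section Cocompact

variable {X E : Type*} [TopologicalSpace X] [TopologicalSpace E] {M : TranslationStructure X}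
  {p : E → X}

/-- Up to deck transformations, finitely many balls of prescribed positive radii cover a simply
connected covering space of a compact space. -/
lemma exists_finite_deck_cover [CompactSpace X] [ConnectedSpace X] [SimplyConnectedSpace E]
    (M : TranslationStructure X) (hp : IsCoveringMap p) {r : E → ℝ} (hr : ∀ y, 0 < r y) :
    ∃ F : Finset E, ∀ z, ∃ y ∈ F, ∃ φ : E ≃ₜ E, (∀ w, p (φ w) = p w) ∧
      φ z ∈ (M.pullback p hp.isLocalHomeomorph).ball y (r y) := by
  obtain ⟨g, hg⟩ := hp.surjective_of_connected.hasRightInverse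
  obtain ⟨t, -, ht⟩ := isCompact_univ.elim_nhds_subcover
    (fun x => p '' (M.pullback p hp.isLocalHomeomorph).ball (g x) (r (g x))) fun x _ => by
      have := hp.isOpenMap.image_mem_nhds
        ((M.pullback p hp.isLocalHomeomorph).ball_mem_nhds (g x) (hr (g x)))
      rwa [hg x] at this
  classical
  refine ⟨t.image g, fun z => ?_⟩
  obtain ⟨x, hx, w, hw, hwz⟩ := mem_iUnion₂.1 (ht (mem_univ (p z)))
  obtain ⟨φ, hφ, hφz⟩ := exists_deck M hp hwz.symm
  exact ⟨g x, Finset.mem_image_of_mem g hx, φ, hφ, hφz ▸ hw⟩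

/-- Deck transformations move any point to within `r y / 2` of one of finitely many centres `y`, so
half the least radius works everywhere. -/
lemma exists_uniform_ball_subset_isCompact [T2Space X] [CompactSpace X] [ConnectedSpace X]
    [SimplyConnectedSpace E] (M : TranslationStructure X) (hp : IsCoveringMap p) :
    ∃ ε > 0, ∀ y, ∃ K, IsCompact K ∧ (M.pullback p hp.isLocalHomeomorph).ball y ε ⊆ K := by
  have := hp.t2Space
  set T := M.pullback p hp.isLocalHomeomorph
  choose r hr K hK hrK using T.exists_ball_subset_isCompact
  obtain ⟨F, hF⟩ := exists_finite_deck_cover M hp (r := fun y => r y / 2) fun y => half_pos (hr y)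
  have hne : F.Nonempty := by
    obtain ⟨z⟩ : Nonempty E := inferInstance
    obtain ⟨y, hy, -⟩ := hF z
    exact ⟨y, hy⟩
  obtain ⟨y₀, hy₀, hmin⟩ := F.exists_min_image r hne
  refine ⟨r y₀ / 2, half_pos (hr y₀), fun z => ?_⟩
  obtain ⟨y, hy, φ, hφ, hz⟩ := hF z
  refine ⟨φ ⁻¹' K y, φ.isCompact_preimage.2 (hK y), fun w hw => hrK y ?_⟩
  have h1 : T.flatEDist (φ z) (φ w) ≤ ENNReal.ofReal (r y / 2) := by
    rw [flatEDist_deck φ hφ]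
    exact hw.trans (ENNReal.ofReal_le_ofReal (by linarith [hmin y hy]))
  have h2 := T.flatEDist_le_ofReal_add (half_pos (hr y)).le (half_pos (hr y)).le hz h1
  rwa [add_halves] at h2

/-- Flat balls in the universal cover of a compact translation surface are relatively compact. -/
lemma exists_isCompact_ball_subset [T2Space X] [CompactSpace X] [ConnectedSpace X]
    [SimplyConnectedSpace E] (M : TranslationStructure X) (hp : IsCoveringMap p) (x : E) (R : ℝ) :
    ∃ K, IsCompact K ∧ (M.pullback p hp.isLocalHomeomorph).ball x R ⊆ K := by
  set T := M.pullback p hp.isLocalHomeomorph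
  obtain ⟨ε, hε, h⟩ := exists_uniform_ball_subset_isCompact M hp
  -- Each step may advance only `ε / 2`: the `ε / 4`-net and the loss `ε / 4` in cutting a broken
  -- line use up the rest of `ε`.
  have hstep : ∀ n : ℕ, ∃ K, IsCompact K ∧ T.ball x (n * (ε / 2)) ⊆ K := by
    intro n
    induction n with
    | zero =>
      obtain ⟨K, hK, hKs⟩ := h x
      refine ⟨K, hK, fun z hz => hKs (le_trans hz (ENNReal.ofReal_le_ofReal ?_))⟩
      simpa using hε.le
    | succ n ih =>
      obtain ⟨K, hK, hKs⟩ := ih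
      choose K' hK' hK's using h
      obtain ⟨t, -, ht⟩ := hK.elim_nhds_subcover (fun y => T.ball y (ε / 4))
        fun y _ => T.ball_mem_nhds y (by positivity)
      refine ⟨⋃ y ∈ t, K' y, t.isCompact_biUnion fun y _ => hK' y, fun z hz => ?_⟩
      have hz' : T.flatEDist x z ≤ ENNReal.ofReal (n * (ε / 2) + ε / 2) := by
        have h1 := hz
        rw [show ((n + 1 : ℕ) : ℝ) * (ε / 2) = n * (ε / 2) + ε / 2 by push_cast; ring] at h1
        exact h1
      obtain ⟨w, hw1, hw2⟩ := T.exists_flatEDist_le_of_le_add (δ := ε / 4) (by positivity)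
        (by positivity) (by positivity) hz'
      obtain ⟨y, hy, hyw⟩ := mem_iUnion₂.1 (ht (hKs hw1))
      refine mem_iUnion₂.2 ⟨y, hy, hK's y ?_⟩
      have := T.flatEDist_le_ofReal_add (by positivity) (by positivity) hyw hw2
      refine this.trans_eq ?_
      congr 1; ring
  obtain ⟨n, hn⟩ := exists_nat_ge (R / (ε / 2))
  obtain ⟨K, hK, hKs⟩ := hstep n
  exact ⟨K, hK, fun z hz => hKs (le_trans hz (ENNReal.ofReal_le_ofReal
    ((div_le_iff₀ (by positivity)).1 hn)))⟩

/-- Deck translates of finitely many unit balls cover `E`. Their centres are at bounded distance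
from `x`, the sum of the distances being a crude bound, and `x` is carried along within its fibre.
-/
lemma exists_fiber_dense [CompactSpace X] [ConnectedSpace X] [SimplyConnectedSpace E]
    (M : TranslationStructure X) (hp : IsCoveringMap p) (x : E) :
    ∃ D : ℝ, 0 ≤ D ∧ ∀ z, ∃ s, p s = p x ∧
      (M.pullback p hp.isLocalHomeomorph).flatEDist s z ≤ ENNReal.ofReal D := by
  set T := M.pullback p hp.isLocalHomeomorph
  obtain ⟨F, hF⟩ := exists_finite_deck_cover M hp (r := fun _ => 1) fun _ => one_pos
  refine ⟨∑ y ∈ F, (T.flatEDist x y).toReal + 1, by positivity, fun z => ?_⟩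
  obtain ⟨y, hy, φ, hφ, hz⟩ := hF z
  refine ⟨φ.symm x, by rw [← hφ, φ.apply_symm_apply], ?_⟩
  rw [← flatEDist_deck φ hφ, φ.apply_symm_apply]
  refine T.flatEDist_le_ofReal_add (by positivity) zero_le_one ?_ hz
  rw [← ENNReal.ofReal_toReal (T.flatEDist_lt_top x y).ne]
  exact ENNReal.ofReal_le_ofReal
    (Finset.single_le_sum (f := fun y => (T.flatEDist x y).toReal) (fun _ _ => by positivity) hy)

/-- The fibre is closed and discrete, and the ball lies in a compact set. -/
lemma finite_fiber_inter_ball [T2Space X] [CompactSpace X] [ConnectedSpace X]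
    [SimplyConnectedSpace E] (M : TranslationStructure X) (hp : IsCoveringMap p) (b : X) (x : E)
    (R : ℝ) : (p ⁻¹' {b} ∩ (M.pullback p hp.isLocalHomeomorph).ball x R).Finite := by
  obtain ⟨K, hK, hKs⟩ := exists_isCompact_ball_subset M hp x R
  have : DiscreteTopology (p ⁻¹' {b}) := (hp b).discreteTopology_fiber
  have hc : IsCompact (K ∩ p ⁻¹' {b}) := hK.inter_right (isClosed_singleton.preimage hp.continuous)
  have hd : IsDiscrete (K ∩ p ⁻¹' {b}) := (IsDiscrete.mk this).mono inter_subset_right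
  exact (hc.finite hd).subset fun z hz => ⟨hKs hz.2, hz.1⟩

/-- The number of points in the fibre of `x` at flat distance at most `R` from `x`. -/
noncomputable def fiberCount (M : TranslationStructure X) (hp : IsCoveringMap p) (x : E) (R : ℝ) :
    ℕ := (p ⁻¹' {p x} ∩ (M.pullback p hp.isLocalHomeomorph).ball x R).ncard

lemma ball_mono (T : TranslationStructure E) (x : E) : Monotone (T.ball x) :=
  fun _ _ h _ hz => le_trans hz (ENNReal.ofReal_le_ofReal h)

lemma ncard_fiber_inter_ball [SimplyConnectedSpace E] (hp : IsCoveringMap p) {x s : E} (hs : p s = p x) (R : ℝ) :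
    (p ⁻¹' {p x} ∩ (M.pullback p hp.isLocalHomeomorph).ball s R).ncard = M.fiberCount hp x R := by
  obtain ⟨φ, hφ, rfl⟩ := exists_deck M hp hs.symm
  rw [fiberCount, ← ncard_image_of_injective
    (p ⁻¹' {p x} ∩ (M.pullback p hp.isLocalHomeomorph).ball x R) φ.injective]
  congr 1
  ext z
  constructor
  · rintro ⟨h1, h2⟩
    refine ⟨φ.symm z, ⟨?_, ?_⟩, by simp⟩
    · have := hφ (φ.symm z)
      rw [φ.apply_symm_apply] at this
      exact this.symm.trans h1
    · have := flatEDist_deck (M := M) (hp := hp.isLocalHomeomorph) φ hφ x (φ.symm z)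
      rw [φ.apply_symm_apply] at this
      exact this.symm.le.trans h2
  · rintro ⟨w, ⟨h1, h2⟩, rfl⟩
    exact ⟨by simpa [hφ] using h1, (flatEDist_deck φ hφ x w).le.trans h2⟩

section Count

variable [T2Space X] [CompactSpace X] [ConnectedSpace X] [SimplyConnectedSpace E]
  (hp : IsCoveringMap p)

lemma fiberCount_mono (x : E) : Monotone (M.fiberCount hp x) := fun _ _ h =>
  ncard_le_ncard (inter_subset_inter_right _ (ball_mono _ x h)) (finite_fiber_inter_ball M hp _ x _)

lemma one_le_fiberCount (x : E) (R : ℝ) : 1 ≤ M.fiberCount hp x R :=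
  (ncard_pos (finite_fiber_inter_ball M hp _ x R)).2 ⟨x, rfl, by simp [ball, flatEDist_self]⟩

/-- Cut a near-shortest broken line from `x` to a fibre point `y` near length `R` and replace the
cut by a fibre point `s` close to it. The first factor counts the `s`, the second the `y` seen from
`s`, a count independent of `s`. The constant is the distance to the fibre plus 1 for the unattained
infimum. -/
lemma exists_fiberCount_add_le (M : TranslationStructure X) (x : E) : ∃ D : ℝ, 0 ≤ D ∧
    ∀ R S : ℝ, 0 ≤ R → 0 ≤ S →
      M.fiberCount hp x (R + S) ≤ M.fiberCount hp x (R + D) * M.fiberCount hp x (S + D) := by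
  set T := M.pullback p hp.isLocalHomeomorph
  obtain ⟨D, hD, h⟩ := exists_fiber_dense M hp x
  refine ⟨D + 1, by positivity, fun R S hR hS => ?_⟩
  have hfin := fun y R => finite_fiber_inter_ball M hp (p x) y R
  classical
  have hsub : (hfin x (R + S)).toFinset ⊆
      (hfin x (R + (D + 1))).toFinset.biUnion fun s => (hfin s (S + (D + 1))).toFinset := by
    intro y hy
    obtain ⟨hy1, hy2⟩ := (hfin _ _).mem_toFinset.1 hy
    obtain ⟨z, hz1, hz2⟩ := T.exists_flatEDist_le_of_le_add hR hS one_pos hy2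
    obtain ⟨s, hs, hsz⟩ := h z
    refine Finset.mem_biUnion.2 ⟨s, (hfin _ _).mem_toFinset.2 ⟨hs, ?_⟩,
      (hfin _ _).mem_toFinset.2 ⟨hy1, ?_⟩⟩
    · rw [T.flatEDist_comm] at hsz
      exact ball_mono T x (by linarith) (T.flatEDist_le_ofReal_add hR hD hz1 hsz)
    · exact ball_mono T s (by linarith)
        (T.flatEDist_le_ofReal_add hD (by positivity) hsz hz2)
  have h1 := (Finset.card_le_card hsub).trans (Finset.card_biUnion_le_card_mul _ _
    (M.fiberCount hp x (S + (D + 1))) fun s hs => by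
      rw [← ncard_eq_toFinset_card _ (hfin _ _)]
      exact (ncard_fiber_inter_ball hp ((hfin _ _).mem_toFinset.1 hs).1 _).le)
  rwa [← ncard_eq_toFinset_card _ (hfin _ _), ← ncard_eq_toFinset_card _ (hfin _ _)] at h1

variable [MeasurableSpace E] [BorelSpace E]

/-- The area of a ball is bounded by the number of fibre points in a slightly larger ball. -/
lemma exists_area_ball_le (M : TranslationStructure X) (x y : E) : ∃ C : ℝ≥0∞, C ≠ ⊤ ∧ ∃ b : ℝ,
    ∀ R, 0 ≤ R → (M.pullback p hp.isLocalHomeomorph).area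
      ((M.pullback p hp.isLocalHomeomorph).ball y R) ≤ C * M.fiberCount hp x (R + b) := by
  have := hp.t2Space
  set T := M.pullback p hp.isLocalHomeomorph
  obtain ⟨D, hD, h⟩ := exists_fiber_dense M hp x
  obtain ⟨K, hK, hKs⟩ := exists_isCompact_ball_subset M hp x D
  refine ⟨T.area K, (area_lt_top_of_isCompact hK).ne, (T.flatEDist x y).toReal + D, fun R hR => ?_⟩
  have hfin := finite_fiber_inter_ball M hp (p x) x (R + ((T.flatEDist x y).toReal + D))
  choose! φ hφ hφx using fun s (hs : p s = p x) => exists_deck M hp hs.symm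
  -- Each point is within `D` of some fibre point `s`, and `φ s '' K` contains the ball of radius
  -- `D` about `s`.
  have hsub : T.ball y R ⊆ ⋃ s ∈ hfin.toFinset, φ s '' K := by
    intro z hz
    obtain ⟨s, hs, hsz⟩ := h z
    refine mem_iUnion₂.2 ⟨s, hfin.mem_toFinset.2 ⟨hs, ?_⟩, (φ s).symm z, hKs ?_, by simp⟩
    · have h1 : T.flatEDist x y ≤ ENNReal.ofReal (T.flatEDist x y).toReal :=
        (ENNReal.ofReal_toReal (T.flatEDist_lt_top x y).ne).ge
      have h2 := T.flatEDist_le_ofReal_add ENNReal.toReal_nonneg hR h1 hz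
      rw [T.flatEDist_comm] at hsz
      exact ball_mono T x (by linarith)
        (T.flatEDist_le_ofReal_add (by positivity) hD h2 hsz)
    · have := flatEDist_deck (M := M) (hp := hp.isLocalHomeomorph) (φ s) (hφ s hs) x ((φ s).symm z)
      rw [hφx s hs, (φ s).apply_symm_apply] at this
      exact this.ge.trans hsz
  calc T.area (T.ball y R) ≤ ∑ s ∈ hfin.toFinset, T.area (φ s '' K) :=
        (measure_mono hsub).trans (measure_biUnion_finset_le _ _)
    _ = ∑ s ∈ hfin.toFinset, T.area K := Finset.sum_congr rfl fun s hs =>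
        area_image_deck (φ s) (hφ s (hfin.mem_toFinset.1 hs).1) hK.measurableSet
    _ = T.area K * M.fiberCount hp x (R + ((T.flatEDist x y).toReal + D)) := by
        rw [Finset.sum_const, nsmul_eq_mul, mul_comm, fiberCount, ncard_eq_toFinset_card _ hfin]

/-- The part of a ball lying over a set of positive area has area bounded below by the number of
fibre points in a slightly smaller ball. -/
lemma exists_le_liftVolume [MeasurableSpace X] [BorelSpace X] (M : TranslationStructure X)
    {A : Set X} (hA : MeasurableSet A) (hpos : 0 < M.area A) (x y : E) :
    ∃ C : ℝ≥0∞, C ≠ 0 ∧ ∃ b : ℝ, ∀ R, 0 ≤ R →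
      C * M.fiberCount hp x R ≤ M.liftVolume p hp A y (R + b) := by
  set T := M.pullback p hp.isLocalHomeomorph
  obtain ⟨c, hc, hcA⟩ := M.exists_chart_of_area_pos hA hpos
  -- In the chart, `A` has positive measure in every neighbourhood of `w`, so it can be cut down to
  -- one sheet and a unit ball about a lift of `c.symm w` without becoming null.
  obtain ⟨w, ⟨hwA, hwt⟩, hw⟩ := exists_mem_forall_mem_nhdsWithin_pos_measure hcA.ne'
  obtain ⟨a, ha⟩ := hp.surjective_of_connected (c.symm w)
  obtain ⟨e, hae, he⟩ := hp.isLocalHomeomorph a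
  set O : Set E := interior (T.ball a 1) ∩ e.source
  have hO : IsOpen O := isOpen_interior.inter e.open_source
  have haO : a ∈ O := ⟨mem_interior_iff_mem_nhds.2 (T.ball_mem_nhds a one_pos), hae⟩
  set W : Set E := O ∩ p ⁻¹' A
  have hW : MeasurableSet W := hO.measurableSet.inter (hA.preimage hp.continuous.measurable)
  have hea : e.symm (c.symm w) = a := by rw [← ha, he, e.left_inv hae]
  have hwe : c.symm w ∈ e.target := by rw [← ha, he]; exact e.map_source hae
  have hWpos : 0 < T.area W := by
    refine lt_of_lt_of_le ?_ (le_area (T := T) (c := e.trans c) ⟨e, he.symm, c, hc, rfl⟩ hW)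
    refine hw _ ?_
    have h1 : ∀ᶠ u in 𝓝 w, c.symm u ∈ e.target :=
      (c.symm.continuousAt hwt).eventually (e.open_target.mem_nhds hwe)
    have h2 : ∀ᶠ u in 𝓝 w, e.symm (c.symm u) ∈ O := by
      have : ContinuousAt (e.symm ∘ c.symm) w :=
        ContinuousAt.comp (e.symm.continuousAt hwe) (c.symm.continuousAt hwt)
      exact this.eventually (hO.mem_nhds (by simpa [hea] using haO))
    filter_upwards [nhdsWithin_le_nhds h1, nhdsWithin_le_nhds h2, self_mem_nhdsWithin]
      with u hu1 hu2 hu3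
    refine ⟨⟨hu2, ?_⟩, ?_⟩
    · change p (e.symm (c.symm u)) ∈ A
      rw [he, e.right_inv hu1]; exact hu3.1
    · rw [OpenPartialHomeomorph.trans_target]; exact ⟨hu3.2, hu1⟩
  set d₁ := (T.flatEDist y x).toReal
  set d₂ := (T.flatEDist x a).toReal
  have hd : ∀ u v, T.flatEDist u v ≤ ENNReal.ofReal (T.flatEDist u v).toReal := fun u v =>
    (ENNReal.ofReal_toReal (T.flatEDist_lt_top u v).ne).ge
  refine ⟨T.area W, hWpos.ne', d₁ + d₂ + 1, fun R hR => ?_⟩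
  have hfin := finite_fiber_inter_ball M hp (p x) x R
  choose! φ hφ hφx using fun s (hs : p s = p x) => exists_deck M hp hs.symm
  have hmem : ∀ s ∈ hfin.toFinset, p s = p x ∧ s ∈ T.ball x R := fun s hs => hfin.mem_toFinset.1 hs
  -- If two translates meet, injectivity of `p` on the sheet makes the two deck maps agree at a
  -- point, hence everywhere, in particular at `x`.
  have hdisj : Set.PairwiseDisjoint (hfin.toFinset : Set E) fun s => φ s '' W := by
    intro s hs t ht hst
    refine Set.disjoint_left.2 ?_
    rintro _ ⟨u, hu, rfl⟩ ⟨v, hv, huv⟩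
    have hs' := (hmem s hs).1
    have ht' := (hmem t ht).1
    have hpuv : p u = p v := by rw [← hφ s hs' u, ← hφ t ht' v, huv]
    obtain rfl : u = v := e.injOn hu.1.2 hv.1.2 (by rwa [he] at hpuv)
    have := hp.eq_of_comp_eq (φ t).continuous (φ s).continuous
      (by ext z; simp [hφ s hs', hφ t ht']) u huv
    exact hst (by rw [← hφx s hs', ← hφx t ht', this])
  have hsub : ⋃ s ∈ hfin.toFinset, φ s '' W ⊆ T.ball y (R + (d₁ + d₂ + 1)) ∩ p ⁻¹' A := by
    refine iUnion₂_subset fun s hs => ?_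
    rintro _ ⟨u, hu, rfl⟩
    obtain ⟨hs', hsR⟩ := hmem s hs
    refine ⟨?_, by simpa [hφ s hs'] using hu.2⟩
    have h1 : T.flatEDist x u ≤ ENNReal.ofReal (d₂ + 1) :=
      T.flatEDist_le_ofReal_add ENNReal.toReal_nonneg zero_le_one (hd x a)
        (show u ∈ T.ball a 1 from interior_subset hu.1.1)
    have h2 : T.flatEDist s (φ s u) ≤ ENNReal.ofReal (d₂ + 1) := by
      have := flatEDist_deck (M := M) (hp := hp.isLocalHomeomorph) (φ s) (hφ s hs') x u
      rw [hφx s hs'] at this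
      exact this.le.trans h1
    have h3 := T.flatEDist_le_ofReal_add ENNReal.toReal_nonneg hR (hd y x) hsR
    exact ball_mono T y (by linarith)
      (T.flatEDist_le_ofReal_add (by positivity) (by positivity) h3 h2)
  calc T.area W * M.fiberCount hp x R = ∑ s ∈ hfin.toFinset, T.area W := by
        rw [Finset.sum_const, nsmul_eq_mul, mul_comm, fiberCount, ncard_eq_toFinset_card _ hfin]
    _ = ∑ s ∈ hfin.toFinset, T.area (φ s '' W) := Finset.sum_congr rfl fun s hs =>
        (area_image_deck (φ s) (hφ s (hmem s hs).1) hW).symm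
    _ = T.area (⋃ s ∈ hfin.toFinset, φ s '' W) :=
        (measure_biUnion_finset hdisj fun s _ => (φ s).toMeasurableEquiv.measurableSet_image.2 hW).symm
    _ ≤ _ := measure_mono hsub

end Count

end Cocompact

end TranslationStructure

/-! ### Exponential growth rates and the conclusion -/

/-- A monotone function `N ≥ 1` on the reals which is submultiplicative up to a shift has an
exponential growth rate. -/
lemma exists_tendsto_log_div_of_submultiplicative {N : ℝ → ℕ} (hmono : Monotone N)
    (hone : ∀ R, 1 ≤ N R) {D : ℝ}
    (hD : ∀ R S : ℝ, 0 ≤ R → 0 ≤ S → N (R + S) ≤ N (R + D) * N (S + D)) (hD0 : 0 ≤ D) :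
    ∃ h : ℝ, ∀ a : ℝ, Tendsto (fun R : ℝ => Real.log (N (R + a)) / R) atTop (𝓝 h) := by
  have hpos : ∀ R, (0 : ℝ) < N R := fun R => by exact_mod_cast hone R
  have hlog0 : ∀ R, 0 ≤ Real.log (N R) := fun R => Real.log_nonneg (by exact_mod_cast hone R)
  have hlogm : ∀ R S, R ≤ S → Real.log (N R) ≤ Real.log (N S) := fun R S h =>
    Real.log_le_log (hpos R) (by exact_mod_cast hmono h)
  -- The shift by `2 * D` makes the sequence exactly subadditive: apply `hD` to `m + D` and `n + D`.
  set u : ℕ → ℝ := fun n => Real.log (N (n + 2 * D)) with hu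
  have hsub : Subadditive u := fun m n => by
    rw [hu]
    simp only
    rw [← Real.log_mul (hpos _).ne' (hpos _).ne']
    refine Real.log_le_log (hpos _) ?_
    have := hD (m + D) (n + D) (by positivity) (by positivity)
    rw [show (m : ℝ) + D + (n + D) = ((m + n : ℕ) : ℝ) + 2 * D by push_cast; ring,
      show (m : ℝ) + D + D = m + 2 * D by ring, show (n : ℝ) + D + D = n + 2 * D by ring] at this
    exact_mod_cast this
  have hlim := hsub.tendsto_lim ⟨0, by rintro _ ⟨n, rfl⟩; exact div_nonneg (hlog0 _) n.cast_nonneg⟩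
  refine ⟨hsub.lim, fun a => ?_⟩
  have hat : ∀ b : ℝ, Tendsto (fun R : ℝ => R + b) atTop atTop := fun b =>
    tendsto_atTop_add_const_right _ b tendsto_id
  have hratio : ∀ b : ℝ, Tendsto (fun R : ℝ => (R + b) / R) atTop (𝓝 1) := fun b => by
    have h1 : Tendsto (fun R : ℝ => 1 + b / R) atTop (𝓝 (1 + 0)) :=
      tendsto_const_nhds.add (tendsto_const_nhds.div_atTop tendsto_id)
    rw [add_zero] at h1
    refine h1.congr' ((eventually_ne_atTop 0).mono fun R hR => ?_)
    field_simp
  have hfl : ∀ b : ℝ, Tendsto (fun R : ℝ => u ⌊R + b⌋₊ / R) atTop (𝓝 hsub.lim) := fun b => by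
    have h1 := hlim.comp (tendsto_nat_floor_atTop.comp (hat b))
    have h2 := ((tendsto_nat_floor_div_atTop (R := ℝ)).comp (hat b)).mul (hratio b)
    have h3 := h1.mul h2
    rw [mul_one, mul_one] at h3
    refine h3.congr' ?_
    filter_upwards [eventually_gt_atTop 0, eventually_ge_atTop (1 - b)] with R hR hRb
    have hf : (0 : ℝ) < ⌊R + b⌋₊ := by
      exact_mod_cast Nat.floor_pos.2 (by linarith)
    have hRb' : R + b ≠ 0 := by intro h; linarith
    simp only [Function.comp]
    field_simp
  have hdiv : ∀ R x y : ℝ, 0 < R → x ≤ y → x / R ≤ y / R := fun R x y hR h =>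
    div_le_div_of_nonneg_right h hR.le
  -- Sandwich: `⌊R + a - 2D⌋ + 2D ≤ R + a ≤ ⌊R + a + 1⌋ + 2D`.
  refine tendsto_of_tendsto_of_tendsto_of_le_of_le' (hfl (a - 2 * D)) (hfl (a + 1)) ?_ ?_
  · filter_upwards [eventually_gt_atTop 0, eventually_ge_atTop (2 * D - a)] with R hR hR2
    refine hdiv _ _ _ hR (hlogm _ _ ?_)
    have := Nat.floor_le (show 0 ≤ R + (a - 2 * D) by linarith)
    linarith
  · filter_upwards [eventually_gt_atTop 0] with R hR
    refine hdiv _ _ _ hR (hlogm _ _ ?_)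
    have := Nat.lt_floor_add_one (R + (a + 1))
    linarith

/-- If `V` lies, up to constant factors and shifts, between multiples of `N`, then it has the same
exponential growth rate. -/
lemma tendsto_ennreal_log_div {N : ℝ → ℕ} (hone : ∀ R, 1 ≤ N R) {h : ℝ}
    (hN : ∀ a : ℝ, Tendsto (fun R : ℝ => Real.log (N (R + a)) / R) atTop (𝓝 h)) {V : ℝ → ℝ≥0∞}
    {c C : ℝ≥0∞} (hc : c ≠ 0) (hC : C ≠ ⊤) {a b : ℝ}
    (hlow : ∀ R, 0 ≤ R → c * N R ≤ V (R + a)) (hup : ∀ R, 0 ≤ R → V R ≤ C * N (R + b)) :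
    Tendsto (fun R : ℝ => ENNReal.log (V R) / (R : EReal)) atTop (𝓝 (h : EReal)) := by
  have hpos : ∀ R, (0 : ℝ) < N R := fun R => by exact_mod_cast hone R
  have hNofReal : ∀ R, ((N R : ℕ) : ℝ≥0∞) = ENNReal.ofReal (N R) := fun R => by simp
  have hlim : ∀ (k a : ℝ), 0 < k → Tendsto (fun R : ℝ => ((Real.log (k * N (R + a)) / R : ℝ) : EReal))
      atTop (𝓝 (h : EReal)) := fun k a hk => by
    refine (continuous_coe_real_ereal.tendsto h).comp ?_
    have h1 := (tendsto_const_nhds (x := Real.log k)).div_atTop (tendsto_id (α := ℝ)) |>.add (hN a)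
    rw [zero_add] at h1
    refine h1.congr fun R => ?_
    rw [Real.log_mul hk.ne' (hpos _).ne', add_div]; rfl
  have hlog : ∀ (k R S : ℝ), 0 < k → ENNReal.log (ENNReal.ofReal k * N S) / (R : EReal) =
      ((Real.log (k * N S) / R : ℝ) : EReal) := fun k R S hk => by
    rw [hNofReal, ← ENNReal.ofReal_mul hk.le,
      ENNReal.log_ofReal_of_pos (mul_pos hk (hpos S)), EReal.coe_div]
  have hdiv : ∀ (R : ℝ) (x y : ℝ≥0∞), 0 < R → x ≤ y →
      ENNReal.log x / (R : EReal) ≤ ENNReal.log y / (R : EReal) := fun R x y hR hxy =>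
    EReal.div_le_div_right_of_nonneg (by exact_mod_cast hR.le) (ENNReal.log_le_log hxy)
  -- `c` may be `⊤`, hence the cap at 1.
  obtain ⟨k, hk, hkc⟩ : ∃ k : ℝ, 0 < k ∧ ENNReal.ofReal k ≤ c := by
    refine ⟨(min c 1).toReal, ENNReal.toReal_pos (by simp [hc]) (by simp), ?_⟩
    rw [ENNReal.ofReal_toReal (by simp)]
    exact min_le_left _ _
  -- The added 1 keeps the real constant positive even if `C = 0`.
  have hK : C ≤ ENNReal.ofReal (C.toReal + 1) := by
    rw [← ENNReal.ofReal_toReal hC]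
    exact ENNReal.ofReal_le_ofReal (by simp)
  refine tendsto_of_tendsto_of_tendsto_of_le_of_le' (hlim k (-a) hk)
    (hlim (C.toReal + 1) b (by positivity)) ?_ ?_
  · filter_upwards [eventually_gt_atTop 0, eventually_ge_atTop a] with R hR hRa
    rw [← hlog k R _ hk]
    refine hdiv _ _ _ hR ?_
    have := hlow (R + -a) (by linarith)
    rw [neg_add_cancel_right] at this
    exact (mul_le_mul' hkc le_rfl).trans this
  · filter_upwards [eventually_gt_atTop 0] with R hR
    rw [← hlog _ R _ (by positivity)]
    exact hdiv _ _ _ hR ((hup R hR.le).trans (mul_le_mul' hK le_rfl))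

theorem mainTheorem6 {X E : Type*}
    [TopologicalSpace X] [T2Space X] [CompactSpace X] [ConnectedSpace X]
    [MeasurableSpace X] [BorelSpace X]
    (M : TranslationStructure X) (hM : M.sing.Nonempty)
    [TopologicalSpace E] [SimplyConnectedSpace E] [MeasurableSpace E] [BorelSpace E]
    (p : E → X) (hp : IsCoveringMap p) :
    ∃ h : ℝ, M.IsEntropy p hp h ∧
      ∀ x : E, p x ∈ M.sing → ∀ A : Set X, MeasurableSet A → 0 < M.area A →
        Tendsto (fun R : ℝ => ENNReal.log (M.liftVolume p hp A x R) / (R : EReal))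
          atTop (𝓝 (h : EReal)) := by
  obtain ⟨x₀⟩ : Nonempty E := inferInstance
  obtain ⟨D, hD0, hD⟩ := TranslationStructure.exists_fiberCount_add_le hp M x₀
  have hone := TranslationStructure.one_le_fiberCount (M := M) hp x₀
  obtain ⟨h, hN⟩ := exists_tendsto_log_div_of_submultiplicative
    (TranslationStructure.fiberCount_mono hp x₀) hone hD hD0
  have key : ∀ x : E, ∀ A : Set X, MeasurableSet A → 0 < M.area A →
      Tendsto (fun R : ℝ => ENNReal.log (M.liftVolume p hp A x R) / (R : EReal))
        atTop (𝓝 (h : EReal)) := fun x A hA hpos => by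
    obtain ⟨c, hc, a, hlow⟩ := TranslationStructure.exists_le_liftVolume hp M hA hpos x₀ x
    obtain ⟨C, hC, b, hup⟩ := TranslationStructure.exists_area_ball_le hp M x₀ x
    exact tendsto_ennreal_log_div hone hN hc hC hlow fun R hR =>
      (measure_mono inter_subset_left).trans (hup R hR)
  -- The entropy itself is the case `A = univ`.
  refine ⟨h, fun x => ?_, fun x _ => key x⟩
  have := key x univ .univ M.area_univ_pos
  simpa [TranslationStructure.liftVolume] using this
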